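/- **Theorem 3.1.** Let $X\subset\mathbb P^n$ be an irreducible complex projective variety, and let $N_X\subset\mathbb P^n\times\mathbb P^n$ be its conormal variety, the Zariski closure of $\{(p,q): p\in X_{reg},\ q\perp T_pX\}$. Let $X^*\subset\mathbb P^n$, the projection of $N_X$ to the second factor, be its dual variety, and let $X^*$ have codimension $c$. Let $g_1,\dots,g_l\in\mathbb C[q_0,\dots,q_n]$ be homogeneous polynomials that define $X^*$, i.e. their zero set is $X^*$ and the scheme they define is generically reduced (for instance, generators of the ideal of $X^*$). (If $X=\mathbb P^n$, so that $X^*=\emptyset$, the affine cone over $X^*$ is taken to be $\{0\}$; thus $c=n+1$ and $g_1,\dots,g_l$ generate $(q_0,\dots,q_n)$.) Let $X'=\{[p_0:\dots:p_n:p_s] : [p_0:\dots:p_n]\in X,\ p_s=p_0+\dots+p_n\}\subset\mathbb P^{n+1}$. For $u\in\mathbb C^{n+1}$ put $u_+=u_0+\dots+u_n$ and let $$\mathcal B_X(u)=\{b : (p,b)\in N_{X'},\ [p_0b_0:\dots:p_nb_n:p_sb_s]=[u_0:\dots:u_n:-u_+]\text{ for some }p\}\subset\mathbb P^{n+1}.$$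 Let $J$ be the Jacobian matrix $(\partial g_j/\partial q_i)$ evaluated at $q=(b_0+b_s,\dots,b_n+b_s)$. In $\mathbb C[b_0,\dots,b_n,b_s]$ let $I_u$ be the ideal generated by $g_j(b_0+b_s,\dots,b_n+b_s)$, $j=1,\dots,l$, and the $(c+1)\times(c+1)$ minors of $$\begin{bmatrix} \frac{u_0}{b_0}\ \cdots\ \frac{u_n}{b_n}\\ J\end{bmatrix}\begin{bmatrix} b_0&&\\&\ddots&\\&&b_n\end{bmatrix},$$ and let $S$ be the ideal generated by the $c\times c$ minors of $J$. Let $$W_u = I_u : \big((b_0b_1\cdots b_nb_s)\cdot S\big)^\infty .$$ Then for generic data $u$, i.e. for all $u\in\mathbb C^{n+1}$ outside the zero set of some nonzero polynomial in $u_0,\dots,u_n$ (which may depend on $X$ and $g_1,\dots,g_l$), the set $\mathcal B_X(u)$ is the variety in $\mathbb P^{n+1}$ of the ideal $W_u$. For such $u$ this variety is also the set of critical points of $l'_u(b)=b_0^{u_0}\cdots b_n^{u_n}b_s^{-u_+}$ on the dual variety $X'^*$ of $X'$, i.e. of the regular points $b$ of $X'^*$ with all coordinates nonzero at which $[\frac{u_0}{b_0}:\dots:\frac{u_n}{b_n}:\frac{-u_+}{b_s}]$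 is orthogonal to $T_bX'^*$. -/

import Mathlib

open MvPolynomial

noncomputable section

namespace DualMLE

/-- Complex projective space with homogeneous coordinates indexed by `σ`. -/
abbrev ProjSpace (σ : Type) : Type := Projectivization ℂ (σ → ℂ)

/-- The common zeros in projective space of a set of homogeneous polynomials. -/
def projZeros {σ : Type} (S : Set (MvPolynomial σ ℂ)) : Set (ProjSpace σ) :=
  {x | ∀ f ∈ S, eval x.rep f = 0}

/-- The affine cone over a subset of projective space. It always contains the origin; in
particular the cone over the empty set is `{0}`. -/
def affineCone {σ : Type} (X : Set (ProjSpace σ)) : Set (σ → ℂ) :=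
  {v | ∀ hv : v ≠ 0, Projectivization.mk ℂ v hv ∈ X}

/-- The homogeneous ideal of a subset of projective space: the polynomials that vanish on the
affine cone. -/
def homIdeal {σ : Type} (X : Set (ProjSpace σ)) : Ideal (MvPolynomial σ ℂ) :=
  vanishingIdeal ℂ (affineCone X)

/-- Irreducible projective varieties. -/
structure IsProjectiveVariety {σ : Type} (X : Set (ProjSpace σ)) : Prop where
  nonempty : X.Nonempty
  closed : ∃ S : Set (MvPolynomial σ ℂ), (∀ f ∈ S, ∃ d, f.IsHomogeneous d) ∧ X = projZeros S
  irreducible : (homIdeal X).IsPrime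

/-- The dimension of the affine cone over `X`, that is `dim X + 1`. -/
def coneDim {σ : Type} (X : Set (ProjSpace σ)) : WithBot ℕ∞ :=
  ringKrullDim (MvPolynomial σ ℂ ⧸ homIdeal X)

/-- `X` has codimension `c` in projective space (the empty set, whose affine cone is the origin,
has codimension the number of homogeneous coordinates). -/
def HasCodim {σ : Type} [Fintype σ] (X : Set (ProjSpace σ)) (c : ℕ) : Prop :=
  coneDim X + (c : WithBot ℕ∞) = (Fintype.card σ : WithBot ℕ∞)

/-- The tangent space `T_p X`, as a linear subspace of the space of homogeneous coordinates
(the tangent space of the affine cone). -/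
def tangentSpace {σ : Type} [Fintype σ] (X : Set (ProjSpace σ)) (p : ProjSpace σ) :
    Submodule ℂ (σ → ℂ) where
  carrier := {v | ∀ f ∈ homIdeal X, ∑ i, eval p.rep (pderiv i f) * v i = 0}
  zero_mem' := by
    intro f _
    simp
  add_mem' := by
    intro v w hv hw f hf
    simp only [Pi.add_apply, mul_add, Finset.sum_add_distrib, hv f hf, hw f hf, add_zero]
  smul_mem' := by
    intro a v hv f hf
    have h := hv f hf
    simp only [Pi.smul_apply, smul_eq_mul]
    calc ∑ i, eval p.rep (pderiv i f) * (a * v i)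
        = a * ∑ i, eval p.rep (pderiv i f) * v i := by
          rw [Finset.mul_sum]
          exact Finset.sum_congr rfl (fun i _ => by ring)
      _ = 0 := by rw [h, mul_zero]

/-- `X_reg`: the points of `X` at which the tangent space has the dimension of `X`. -/
def regularPoints {σ : Type} [Fintype σ] (X : Set (ProjSpace σ)) : Set (ProjSpace σ) :=
  {p | p ∈ X ∧ ((Module.finrank ℂ (tangentSpace X p) : ℕ) : WithBot ℕ∞) = coneDim X}

/-- `F` is homogeneous of degree `d` in the first group of variables and of degree `e` in the
second one. -/
def IsBihomogeneous {σ τ : Type} (F : MvPolynomial (σ ⊕ τ) ℂ) (d e : ℕ) : Prop :=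
  F.IsWeightedHomogeneous (Sum.elim (fun _ => 1) (fun _ => 0) : σ ⊕ τ → ℕ) d ∧
    F.IsWeightedHomogeneous (Sum.elim (fun _ => 0) (fun _ => 1) : σ ⊕ τ → ℕ) e

/-- The Zariski closure in a product of two projective spaces. -/
def biClosure {σ τ : Type} (Z : Set (ProjSpace σ × ProjSpace τ)) :
    Set (ProjSpace σ × ProjSpace τ) :=
  {x | ∀ (F : MvPolynomial (σ ⊕ τ) ℂ) (d e : ℕ), IsBihomogeneous F d e →
    (∀ z ∈ Z, eval (Sum.elim z.1.rep z.2.rep) F = 0) → eval (Sum.elim x.1.rep x.2.rep) F = 0}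

/-- The conormal variety `N_X`: the closure of `{(p, q) : p ∈ X_reg, q ⟂ T_p X}`. -/
def conormalVariety {σ : Type} [Fintype σ] (X : Set (ProjSpace σ)) :
    Set (ProjSpace σ × ProjSpace σ) :=
  biClosure {x | x.1 ∈ regularPoints X ∧ ∀ v ∈ tangentSpace X x.1, ∑ i, x.2.rep i * v i = 0}

/-- The dual variety: the projection of the conormal variety to the second factor. -/
def dualVariety {σ : Type} [Fintype σ] (X : Set (ProjSpace σ)) : Set (ProjSpace σ) :=
  Prod.snd '' conormalVariety X

/-- The copy `X'` of `X` in the projective space with one more coordinate `p_s` (the last one):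
the points `[p_0 : ⋯ : p_n : p_s]` with `[p_0 : ⋯ : p_n] ∈ X` and `p_s = p_0 + ⋯ + p_n`. -/
def sumEmbedding {n : ℕ} (X : Set (ProjSpace (Fin (n + 1)))) : Set (ProjSpace (Fin (n + 2))) :=
  {x | (fun i : Fin (n + 1) => x.rep i.castSucc) ∈ affineCone X ∧
    x.rep (Fin.last (n + 1)) = ∑ i : Fin (n + 1), x.rep i.castSucc}

/-- The vector `(u_0, …, u_n, -u_+)`. -/
def extData {n : ℕ} (u : Fin (n + 1) → ℂ) : Fin (n + 2) → ℂ :=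
  Fin.snoc (α := fun _ => ℂ) u (-∑ i, u i)

/-- The likelihood locus `L_X(u)`: the points `(p, b)` of the conormal variety of `X'` with
`[p_0 b_0 : ⋯ : p_n b_n : p_s b_s] = [u_0 : ⋯ : u_n : -u_+]`. -/
def likelihoodLocus {n : ℕ} (X : Set (ProjSpace (Fin (n + 1)))) (u : Fin (n + 1) → ℂ) :
    Set (ProjSpace (Fin (n + 2)) × ProjSpace (Fin (n + 2))) :=
  {x | x ∈ conormalVariety (sumEmbedding X) ∧
    ∃ t : ℂ, t ≠ 0 ∧ ∀ i, x.1.rep i * x.2.rep i = t * extData u i}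

/-- `B_X(u) = {b : (p, b) ∈ L_X(u)}`. -/
def dualLikelihoodLocus {n : ℕ} (X : Set (ProjSpace (Fin (n + 1)))) (u : Fin (n + 1) → ℂ) :
    Set (ProjSpace (Fin (n + 2))) :=
  Prod.snd '' likelihoodLocus X u

/-- The critical points of `b_0 ^ u_0 ⋯ b_n ^ u_n * b_s ^ (-u_+)` on the dual variety of `X'`:
the regular points with nonzero coordinates at which the gradient
`(u_0 / b_0, …, u_n / b_n, -u_+ / b_s)` is orthogonal to the tangent space. -/
def dualCriticalPoints {n : ℕ} (X : Set (ProjSpace (Fin (n + 1)))) (u : Fin (n + 1) → ℂ) :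
    Set (ProjSpace (Fin (n + 2))) :=
  {b | b ∈ regularPoints (dualVariety (sumEmbedding X)) ∧ (∀ i, b.rep i ≠ 0) ∧
    ∀ v ∈ tangentSpace (dualVariety (sumEmbedding X)) b,
      ∑ i, extData u i / b.rep i * v i = 0}

/-- The homogeneous polynomials `g_1, …, g_l` define the irreducible variety `Y`: their zero set
is `Y` (as an equality of affine cones) and the scheme that they define is generically reduced,
i.e. `(g_1, …, g_l)` and the ideal of `Y` agree after localization at the generic point of `Y`. -/
structure DefinesVariety {σ : Type} {l : ℕ} (g : Fin l → MvPolynomial σ ℂ)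
    (Y : Set (ProjSpace σ)) : Prop where
  homogeneous : ∀ j, ∃ d, (g j).IsHomogeneous d
  zeros : {v : σ → ℂ | ∀ j, eval v (g j) = 0} = affineCone Y
  genericallyReduced :
    ∃ h, h ∉ homIdeal Y ∧ ∀ f ∈ homIdeal Y, h * f ∈ Ideal.span (Set.range g)

/-- The ideal generated by the `k × k` minors of a matrix. -/
def minorsIdeal {R : Type} [CommRing R] {a b : ℕ} (k : ℕ) (M : Matrix (Fin a) (Fin b) R) :
    Ideal R :=
  Ideal.span {d | ∃ (r : Fin k ↪o Fin a) (s : Fin k ↪o Fin b), d = (M.submatrix r s).det}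

/-- The saturation `I : J^∞ = ⋃ N, (I : J ^ N)` (an increasing union of ideals). -/
def saturation {R : Type} [CommRing R] (I J : Ideal R) : Ideal R :=
  ⨆ N : ℕ, Submodule.colon I ((J ^ N : Ideal R) : Set R)

/-- The substitution `q_i ↦ b_i + b_s`. -/
def shift (n : ℕ) : MvPolynomial (Fin (n + 1)) ℂ →ₐ[ℂ] MvPolynomial (Fin (n + 2)) ℂ :=
  aeval (fun i => X i.castSucc + X (Fin.last (n + 1)))

/-- The Jacobian matrix `(∂ g_j / ∂ q_i)` evaluated at `(b_0 + b_s, …, b_n + b_s)`. -/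
def shiftedJacobian {n l : ℕ} (g : Fin l → MvPolynomial (Fin (n + 1)) ℂ) :
    Matrix (Fin l) (Fin (n + 1)) (MvPolynomial (Fin (n + 2)) ℂ) :=
  Matrix.of fun j i => shift n (pderiv i (g j))

/-- The product of the evaluated Jacobian, extended by the top row `(u_0 / b_0, …, u_n / b_n)`,
with the diagonal matrix `diag(b_0, …, b_n)`. Its entries are polynomials: those of the top row
are `u_0, …, u_n`. -/
def extendedJacobian {n l : ℕ} (g : Fin l → MvPolynomial (Fin (n + 1)) ℂ)
    (u : Fin (n + 1) → ℂ) :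
    Matrix (Fin (l + 1)) (Fin (n + 1)) (MvPolynomial (Fin (n + 2)) ℂ) :=
  Matrix.of (Matrix.vecCons (fun i => C (u i))
    (shiftedJacobian g * Matrix.diagonal fun i : Fin (n + 1) => X i.castSucc))

/-- The ideal of the dual likelihood equations. -/
def dualLikelihoodIdeal {n l : ℕ} (g : Fin l → MvPolynomial (Fin (n + 1)) ℂ) (c : ℕ)
    (u : Fin (n + 1) → ℂ) : Ideal (MvPolynomial (Fin (n + 2)) ℂ) :=
  saturation
    (Ideal.span (Set.range fun j => shift n (g j)) ⊔ minorsIdeal (c + 1) (extendedJacobian g u))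
    (Ideal.span {∏ i : Fin (n + 2), X i} * minorsIdeal c (shiftedJacobian g))

end DualMLE

end

/-!
Over an irreducible cone of dimension `e` in `k ^ m` the conormal variety is a bundle of normal
spaces, of dimension `m - e` at the generic point by the theory of derivations in characteristic
zero; so it is irreducible of dimension `m`. Differentiating along it shows that a conormal vector
of the cone has its base point normal to the dual cone, and since both conormal varieties have
dimension `m`, this inclusion is an equality: biduality.

The transpose of `p ↦ (p, ∑ p_i)` is `b ↦ (b_0 + b_s, …, b_n + b_s)`, hence a pair `((p, ∑ p_i), b)`
is conormal to `X'` exactly when `p` and the shifted vector of `b` are conormal to `X`. Where the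
coordinates of `b` and a suitable `c × c` minor of the Jacobian at the shifted vector do not vanish,
the gradients of the `g_j` span the normal space of `X^*` there. The `(c + 1) × (c + 1)` minors then
say that `(u_i / b_i)` is such a normal vector, and biduality turns this into `b ∈ B_X(u)`; the
remaining coordinate of `p` is supplied by Euler's relation.

What is left is to choose `u` so that no point of the closure of the likelihood locus lies over `u`
and on a given hypersurface `f(b) = 0`. The conormal variety of `X'` has dimension `n + 2`, so on it
`f(b)` satisfies an algebraic relation over the `n + 2` functions `u_i = p_i b_i` and `b_j`. The
constant coefficient `F(u, b_j)` of this relation may be taken nonzero, and it vanishes wherever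
`f(b)` does; as `b` can be rescaled when `f` is homogeneous, so does each coefficient of
`F` with respect to `b_j`, which is a condition on `u` alone.
-/

open MvPolynomial

noncomputable section

namespace DualMLE

section Derivation

open KaehlerDifferential TensorProduct

/-- The first fundamental sequence of Kähler differentials is split injective on the left as soon
as `L` is formally smooth over `R`. -/
theorem exists_derivation_extension {k R L : Type*} [CommRing k] [CommRing R] [Field L]
    [Algebra k R] [Algebra R L] [Algebra k L] [IsScalarTower k R L] [Algebra.FormallySmooth R L]
    (D : Derivation k R L) :
    ∃ D' : Derivation k L L, ∀ r, D' (algebraMap R L r) = D r := by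
  have injective : Function.Injective (mapBaseChange k R L) := by
    rw [injective_iff_map_eq_zero]
    intro x hx
    obtain ⟨x, rfl⟩ := (Algebra.H1Cotangent.exact_δ_mapBaseChange k R L x).mp hx
    rw [Subsingleton.elim x 0, map_zero]
  obtain ⟨g, hg⟩ := (mapBaseChange k R L).exists_leftInverse_of_injective
    (LinearMap.ker_eq_bot.2 injective)
  let φ : L ⊗[R] Ω[R⁄k] →ₗ[L] L := D.liftKaehlerDifferential.liftBaseChange L
  refine ⟨(φ ∘ₗ g).compDer (KaehlerDifferential.D k L), fun r => ?_⟩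
  have D_eq : KaehlerDifferential.D k L (algebraMap R L r) =
      mapBaseChange k R L (1 ⊗ₜ KaehlerDifferential.D k R r) := by
    simp
  have g_eq := LinearMap.congr_fun hg (1 ⊗ₜ KaehlerDifferential.D k R r)
  rw [LinearMap.comp_apply, LinearMap.id_apply] at g_eq
  change φ (g (KaehlerDifferential.D k L (algebraMap R L r))) = _
  rw [D_eq, g_eq]
  simp [φ]

theorem formallyEtale_of_isAlgebraic {R K : Type*} [CommRing R] [IsDomain R] [CharZero R]
    [Field K] [Algebra R K] [FaithfulSMul R K] [Algebra.IsAlgebraic R K] :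
    Algebra.FormallyEtale R K := by
  let : Algebra (FractionRing R) K := FractionRing.liftAlgebra R K
  have : Algebra.FormallyEtale R (FractionRing R) :=
    Algebra.FormallyEtale.of_isLocalization (nonZeroDivisors R)
  have : CharZero (FractionRing R) :=
    charZero_of_injective_algebraMap (IsFractionRing.injective R (FractionRing R))
  have : Algebra.IsAlgebraic (FractionRing R) K :=
    (IsFractionRing.comap_isAlgebraic_iff (A := R) (K := FractionRing R) (C := K)).1 inferInstance
  have : Algebra.FormallyEtale (FractionRing R) K := Algebra.FormallyEtale.of_isSeparable _ _
  exact Algebra.FormallyEtale.comp R (FractionRing R) K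

theorem formallyEtale_aeval_of_isTranscendenceBasis {R K ι : Type*} [CommRing R] [IsDomain R]
    [CharZero R] [Field K] [Algebra R K] {x : ι → K} (hx : IsTranscendenceBasis R x) :
    (aeval x : MvPolynomial ι R →ₐ[R] K).toRingHom.FormallyEtale := by
  let : Algebra (MvPolynomial ι R) K := (aeval x).toAlgebra
  have : FaithfulSMul (MvPolynomial ι R) K :=
    (faithfulSMul_iff_algebraMap_injective _ _).2 hx.1
  have : Algebra.IsAlgebraic (MvPolynomial ι R) K := by
    have isAlgebraic_adjoin := hx.isAlgebraic
    exact (Algebra.isAlgebraic_ringHom_iff_of_comp_eq hx.1.aevalEquiv (RingEquiv.refl K)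
      (RingHom.ext hx.1.algebraMap_aevalEquiv)).1 isAlgebraic_adjoin
  exact formallyEtale_of_isAlgebraic

theorem formallySmooth_of_charZero {R K : Type*} [CommRing R] [IsDomain R] [CharZero R]
    [Field K] [Algebra R K] [FaithfulSMul R K] : Algebra.FormallySmooth R K := by
  obtain ⟨s, hs⟩ := exists_isTranscendenceBasis R K
  let : Algebra (MvPolynomial s R) K := (aeval ((↑) : s → K)).toAlgebra
  have : IsScalarTower R (MvPolynomial s R) K :=
    .of_algebraMap_eq fun c => (AlgHom.commutes (aeval ((↑) : s → K)) c).symm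
  have : Algebra.FormallyEtale (MvPolynomial s R) K :=
    formallyEtale_aeval_of_isTranscendenceBasis hs
  exact .comp R (MvPolynomial s R) K

theorem finrank_derivation_of_isTranscendenceBasis {k K ι : Type*} [Field k] [CharZero k]
    [Field K] [Algebra k K] [Finite ι] {x : ι → K} (hx : IsTranscendenceBasis k x) :
    Module.finrank K (Derivation k K K) = Nat.card ι := by
  let : Algebra (MvPolynomial ι k) K := (aeval x).toAlgebra
  have : IsScalarTower k (MvPolynomial ι k) K :=
    .of_algebraMap_eq fun c => (AlgHom.commutes (aeval x) c).symm
  have : Algebra.FormallyEtale (MvPolynomial ι k) K :=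
    formallyEtale_aeval_of_isTranscendenceBasis hx
  let b : Module.Basis ι K (Ω[K⁄k]) :=
    ((mvPolynomialBasis k ι).baseChange K).map
      (tensorKaehlerEquivOfFormallyEtale k (MvPolynomial ι k) K)
  have : Module.Finite K (Ω[K⁄k]) := Module.Finite.of_basis b
  rw [← (linearMapEquivDerivation k K (M := K)).finrank_eq, Module.finrank_linearMap_self,
    Module.finrank_eq_nat_card_basis b]

theorem exists_derivation_of_surjective {k R A M : Type*} [CommRing k] [CommRing R] [CommRing A]
    [Algebra k R] [Algebra k A] [Algebra R A] [IsScalarTower k R A] [AddCommGroup M] [Module k M]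
    [Module R M] [Module A M] [IsScalarTower R A M]
    (surjective : Function.Surjective (algebraMap R A)) (D : Derivation k R M)
    (hD : ∀ r, algebraMap R A r = 0 → D r = 0) :
    ∃ D' : Derivation k A M, ∀ r, D' (algebraMap R A r) = D r := by
  let π : R →ₗ[k] A := (IsScalarTower.toAlgHom k R A).toLinearMap
  let D' : A →ₗ[k] M := (LinearMap.ker π).liftQ (D : R →ₗ[k] M) hD ∘ₗ
    (π.quotKerEquivOfSurjective surjective).symm
  have D'_algebraMap (r : R) : D' (algebraMap R A r) = D r :=
    congrArg ((LinearMap.ker π).liftQ (D : R →ₗ[k] M) hD)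
      (LinearMap.quotKerEquivOfSurjective_symm_apply π surjective r)
  refine ⟨Derivation.mk' D' fun a b => ?_, D'_algebraMap⟩
  obtain ⟨r, rfl⟩ := surjective a
  obtain ⟨s, rfl⟩ := surjective b
  rw [← map_mul, D'_algebraMap, D'_algebraMap, D'_algebraMap, D.leibniz, algebraMap_smul,
    algebraMap_smul]

end Derivation

section KrullDim

theorem ringKrullDim_eq_of_isIntegral (R S : Type*) [CommRing R] [CommRing S] [Algebra R S]
    [FaithfulSMul R S] [Algebra.IsIntegral R S] : ringKrullDim S = ringKrullDim R := by
  apply le_antisymm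
  · exact Order.krullDim_le_of_strictMono (PrimeSpectrum.comap (algebraMap R S))
      fun _ _ lt => Ideal.IsIntegral.comap_lt_comap (R := R) lt
  · refine iSup_le fun l => ?_
    have ker_le : RingHom.ker (algebraMap R S) ≤ l.head.asIdeal := by
      rw [(RingHom.injective_iff_ker_eq_bot _).1 (FaithfulSMul.algebraMap_injective R S)]
      exact bot_le
    obtain ⟨P, -, _, hP⟩ :=
      Ideal.exists_ideal_over_prime_of_isIntegral (S := S) l.head.asIdeal ⊥ ker_le
    have : P.LiesOver l.head.asIdeal := ⟨hP.symm⟩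
    obtain ⟨M, hM, -⟩ := Ideal.exists_ltSeries_of_hasGoingUp l P
    rw [← hM]
    exact le_iSup (fun p : LTSeries (PrimeSpectrum S) => ((p.length : ℕ) : WithBot ℕ∞)) M

theorem exists_isTranscendenceBasis_ringKrullDim_eq (k A K : Type*) [Field k] [CommRing A]
    [IsDomain A] [Algebra k A] [Algebra.FiniteType k A] [Field K] [Algebra A K]
    [IsFractionRing A K] [Algebra k K] [IsScalarTower k A K] :
    ∃ (d : ℕ) (x : Fin d → K), IsTranscendenceBasis k x ∧ ringKrullDim A = d := by
  obtain ⟨d, g, g_injective, g_isIntegral⟩ := exists_integral_inj_algHom_of_fg k A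
  let : Algebra (MvPolynomial (Fin d) k) A := g.toAlgebra
  have : IsScalarTower k (MvPolynomial (Fin d) k) A :=
    .of_algebraMap_eq fun c => (g.commutes c).symm
  have : FaithfulSMul (MvPolynomial (Fin d) k) A :=
    (faithfulSMul_iff_algebraMap_injective _ _).2 g_injective
  have : Algebra.IsIntegral (MvPolynomial (Fin d) k) A := ⟨g_isIntegral⟩
  have : Algebra.IsAlgebraic A K :=
    (IsFractionRing.comap_isAlgebraic_iff (A := A) (K := K) (C := K)).2 inferInstance
  have basis : IsTranscendenceBasis k (algebraMap (MvPolynomial (Fin d) k) A ∘ X) :=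
    (IsTranscendenceBasis.mvPolynomial (Fin d) k).algebraMap_comp
  refine ⟨d, algebraMap A K ∘ (algebraMap (MvPolynomial (Fin d) k) A ∘ X),
    basis.algebraMap_comp, ?_⟩
  rw [ringKrullDim_eq_of_isIntegral (MvPolynomial (Fin d) k) A,
    MvPolynomial.ringKrullDim_of_isNoetherianRing, ringKrullDim_eq_zero_of_field, zero_add,
    Nat.card_fin]

end KrullDim

section Matrix

open scoped Matrix

theorem exists_submatrix_det_ne_zero {K σ : Type*} [Field K] [Finite σ] {r : ℕ}
    {M : Matrix (Fin r) σ K} (hM : LinearIndependent K M.row) :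
    ∃ s : Fin r → σ, (M.submatrix id s).det ≠ 0 := by
  have := Fintype.ofFinite σ
  have finrank_cols : Module.finrank K (Submodule.span K (Set.range M.col)) = r := by
    rw [← M.rank_eq_finrank_span_cols, hM.rank_matrix, Fintype.card_fin]
  obtain ⟨f, hf, -, f_linearIndependent⟩ :=
    Submodule.exists_fun_fin_finrank_span_eq K (Set.range M.col)
  choose s hs using hf
  refine ⟨s ∘ Fin.cast finrank_cols.symm, ?_⟩
  rw [← isUnit_iff_ne_zero, ← Matrix.isUnit_iff_isUnit_det,
    ← Matrix.linearIndependent_cols_iff_isUnit]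
  have cols : (M.submatrix id (s ∘ Fin.cast finrank_cols.symm)).col =
      f ∘ Fin.cast finrank_cols.symm := funext fun j => hs (Fin.cast finrank_cols.symm j)
  rw [cols]
  exact f_linearIndependent.comp _ (Fin.cast_injective finrank_cols.symm)

theorem exists_orderEmbedding_comp_perm {α : Type*} [LinearOrder α] {m : ℕ} {f : Fin m → α}
    (hf : Function.Injective f) :
    ∃ (g : Fin m ↪o α) (e : Equiv.Perm (Fin m)), f = g ∘ e := by
  have strictMono : StrictMono (f ∘ Tuple.sort f) :=
    (Tuple.monotone_sort f).strictMono_of_injective (hf.comp (Tuple.sort f).injective)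
  refine ⟨OrderEmbedding.ofStrictMono _ strictMono, (Tuple.sort f).symm, ?_⟩
  ext i
  simp

theorem exists_orderEmbedding_det_notMem {R m n : Type*} [CommRing R] [LinearOrder m]
    [LinearOrder n] {c : ℕ} (M : Matrix m n R) {r : Fin c → m} {s : Fin c → n} {I : Ideal R}
    (h : (M.submatrix r s).det ∉ I) :
    ∃ (r' : Fin c ↪o m) (s' : Fin c ↪o n), (M.submatrix r' s').det ∉ I := by
  have r_injective : Function.Injective r := fun i j hij => by
    by_contra hne
    exact h (by rw [Matrix.det_zero_of_row_eq hne (by ext; simp [hij])]; exact I.zero_mem)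
  have s_injective : Function.Injective s := fun i j hij => by
    by_contra hne
    exact h (by rw [Matrix.det_zero_of_column_eq hne (by simp [hij])]; exact I.zero_mem)
  obtain ⟨r', e, rfl⟩ := exists_orderEmbedding_comp_perm r_injective
  obtain ⟨s', e', rfl⟩ := exists_orderEmbedding_comp_perm s_injective
  refine ⟨r', s', fun hI => h ?_⟩
  have submatrix_eq : M.submatrix (r' ∘ e) (s' ∘ e') =
      ((M.submatrix r' s').submatrix e id).submatrix id e' := rfl
  rw [submatrix_eq, Matrix.det_permute', Matrix.det_permute]
  exact I.mul_mem_left _ (I.mul_mem_left _ hI)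

theorem det_smul_eq_vecMul_adjugate_vecMul {R ι σ : Type*} [CommRing R] [Fintype ι]
    [DecidableEq ι] (M : Matrix ι σ R) (s : ι → σ) {c : ι → R} {v : σ → R}
    (hv : v = c ᵥ* M) :
    (M.submatrix id s).det • v = ((v ∘ s) ᵥ* (M.submatrix id s).adjugate) ᵥ* M := by
  have restrict : v ∘ s = c ᵥ* M.submatrix id s := by
    rw [hv]
    rfl
  rw [restrict, Matrix.vecMul_vecMul _ _ (Matrix.adjugate _), Matrix.mul_adjugate,
    Matrix.vecMul_smul, Matrix.vecMul_one, Matrix.smul_vecMul, ← hv]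

theorem submatrix_det_eq_zero_of_finrank_lt {K σ ι : Type*} [Field K] [Finite σ] [Fintype ι]
    [DecidableEq ι] {W : Submodule K (σ → K)} (hW : Module.finrank K W < Fintype.card ι)
    {M : Matrix ι σ K} (hM : ∀ j, M j ∈ W) (s : ι → σ) :
    (M.submatrix id s).det = 0 := by
  contrapose! hW
  rw [← isUnit_iff_ne_zero, ← Matrix.isUnit_iff_isUnit_det,
    ← Matrix.linearIndependent_rows_iff_isUnit] at hW
  have rows : LinearIndependent K M.row := .of_comp (LinearMap.funLeft K K s) hW
  have rows_mem : LinearIndependent K fun j => (⟨M j, hM j⟩ : W) := .of_comp W.subtype rows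
  exact rows_mem.fintype_card_le_finrank

end Matrix

section Perp

variable {K σ : Type*} [Fintype σ]

/-- The orthogonal complement of a subspace for the standard dot product. -/
def perp [CommRing K] (W : Submodule K (σ → K)) : Submodule K (σ → K) :=
  LinearMap.BilinForm.orthogonal (dotProductBilin K K) W

theorem mem_perp [CommRing K] {W : Submodule K (σ → K)} {v : σ → K} :
    v ∈ perp W ↔ ∀ w ∈ W, w ⬝ᵥ v = 0 := Iff.rfl

theorem mem_perp_span [CommRing K] {S : Set (σ → K)} {v : σ → K} :
    v ∈ perp (Submodule.span K S) ↔ ∀ w ∈ S, w ⬝ᵥ v = 0 := by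
  refine ⟨fun hv w hw => hv w (Submodule.subset_span hw), fun hv w hw => ?_⟩
  have span_le : Submodule.span K S ≤ LinearMap.ker ((dotProductBilin K K).flip v) :=
    Submodule.span_le.2 hv
  exact span_le hw

variable [Field K]

theorem nondegenerate_dotProductBilin :
    (dotProductBilin K K : LinearMap.BilinForm K (σ → K)).Nondegenerate :=
  ⟨fun v hv => dotProduct_eq_zero v hv,
    fun v hv => dotProduct_eq_zero v fun w => (dotProduct_comm v w).trans (hv w)⟩

theorem perp_perp (W : Submodule K (σ → K)) : perp (perp W) = W :=
  LinearMap.BilinForm.orthogonal_orthogonal nondegenerate_dotProductBilin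
    (fun v w h => (dotProduct_comm w v).trans h) W

theorem finrank_add_finrank_perp (W : Submodule K (σ → K)) :
    Module.finrank K W + Module.finrank K (perp W) = Fintype.card σ := by
  rw [perp, LinearMap.BilinForm.finrank_orthogonal nondegenerate_dotProductBilin,
    Nat.add_sub_cancel' W.finrank_le, Module.finrank_fintype_fun_eq_card]

end Perp

section NormalSpan

variable {k σ E : Type*} [CommRing k] [CommRing E] [Algebra k E]

/-- The gradient of a polynomial at a point with coordinates in a `k`-algebra. -/
def gradient (y : σ → E) (f : MvPolynomial σ k) : σ → E := fun i => aeval y (pderiv i f)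

/-- The span of the gradients at `y` of the elements of `I`: the normal space of the
variety of `I`, when `y` is a regular point of it. -/
def normalSpan (I : Ideal (MvPolynomial σ k)) (y : σ → E) : Submodule E (σ → E) :=
  Submodule.span E (gradient y '' (I : Set (MvPolynomial σ k)))

theorem gradient_mem_normalSpan {I : Ideal (MvPolynomial σ k)} (y : σ → E) {f : MvPolynomial σ k}
    (hf : f ∈ I) : gradient y f ∈ normalSpan I y :=
  Submodule.subset_span ⟨f, hf, rfl⟩

theorem normalSpan_le {I : Ideal (MvPolynomial σ k)} {y : σ → E} {W : Submodule E (σ → E)} :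
    normalSpan I y ≤ W ↔ ∀ f ∈ I, gradient y f ∈ W := by
  rw [normalSpan, Submodule.span_le, Set.image_subset_iff]
  rfl

theorem mem_normalSpan_iff {I : Ideal (MvPolynomial σ k)} {y z : σ → E} :
    z ∈ normalSpan I y ↔ ∃ (n : ℕ) (c : Fin n → E) (h : Fin n → MvPolynomial σ k),
      (∀ j, h j ∈ I) ∧ z = ∑ j, c j • gradient y (h j) := by
  rw [normalSpan, Submodule.mem_span_set']
  constructor
  · rintro ⟨n, c, g, rfl⟩
    choose h hI hg using fun j => (g j).2
    exact ⟨n, c, h, hI, by simp only [hg]⟩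
  · rintro ⟨n, c, h, hI, rfl⟩
    exact ⟨n, c, fun j => ⟨gradient y (h j), h j, hI j, rfl⟩, rfl⟩

theorem comp_gradient {E' : Type*} [CommRing E'] [Algebra k E'] (φ : E →ₐ[k] E') (y : σ → E)
    (f : MvPolynomial σ k) : φ ∘ gradient y f = gradient (φ ∘ y) f :=
  funext fun _ => comp_aeval_apply _ _ _

theorem comp_mem_normalSpan {E' : Type*} [CommRing E'] [Algebra k E'] (φ : E →ₐ[k] E')
    {I : Ideal (MvPolynomial σ k)} {y z : σ → E} (hz : z ∈ normalSpan I y) :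
    φ ∘ z ∈ normalSpan I (φ ∘ y) := by
  obtain ⟨n, c, h, hI, rfl⟩ := mem_normalSpan_iff.1 hz
  refine mem_normalSpan_iff.2 ⟨n, φ ∘ c, h, hI, ?_⟩
  ext i
  simp [← comp_gradient]

theorem gradient_mul (y : σ → E) (f g : MvPolynomial σ k) :
    gradient y (f * g) = aeval y f • gradient y g + aeval y g • gradient y f := by
  ext i
  simp [gradient]

variable [Fintype σ]

theorem mem_perp_normalSpan {I : Ideal (MvPolynomial σ k)} {y v : σ → E} :
    v ∈ perp (normalSpan I y) ↔ ∀ f ∈ I, gradient y f ⬝ᵥ v = 0 := by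
  rw [normalSpan, mem_perp_span, Set.forall_mem_image]
  rfl

theorem derivation_aeval {M : Type*} [AddCommGroup M] [Module E M] [Module k M]
    (D : Derivation k E M) (y : σ → E) (f : MvPolynomial σ k) :
    D (aeval y f) = ∑ i, gradient y f i • D (y i) := by
  classical
  induction f using MvPolynomial.induction_on with
  | C a => simp [gradient, MvPolynomial.algHom_C]
  | add f g hf hg =>
    rw [map_add, map_add, hf, hg, ← Finset.sum_add_distrib]
    simp [gradient, add_smul]
  | mul_X f j hf =>
    have gradient_X : ∑ i, gradient y (X j : MvPolynomial σ k) i • D (y i) = D (y j) := by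
      simp [gradient, pderiv_X, Pi.single_apply, apply_ite (aeval y), ite_smul]
    simp only [map_mul, D.leibniz, hf, gradient_mul, Pi.add_apply, Pi.smul_apply, add_smul,
      Finset.sum_add_distrib, smul_assoc, ← Finset.smul_sum, aeval_X, gradient_X]

theorem derivation_comp_mem_perp_normalSpan {I : Ideal (MvPolynomial σ k)} {y : σ → E}
    (hy : ∀ f ∈ I, aeval y f = 0) (D : Derivation k E E) :
    D ∘ y ∈ perp (normalSpan I y) := by
  refine mem_perp_normalSpan.2 fun f hf => ?_
  have D_aeval := derivation_aeval D y f
  rw [hy f hf, D.map_zero] at D_aeval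
  exact D_aeval.symm

theorem exists_derivation_of_mem_perp_normalSpan {k L : Type*} [Field k] [CharZero k] [Field L]
    [Algebra k L] {y v : σ → L}
    (hv : v ∈ perp (normalSpan (RingHom.ker (aeval y : MvPolynomial σ k →ₐ[k] L)) y)) :
    ∃ D : Derivation k L L, ∀ i, D (y i) = v i := by
  let φ : MvPolynomial σ k →ₐ[k] L := aeval y
  let : Algebra (MvPolynomial σ k) L := φ.toAlgebra
  let : Algebra (MvPolynomial σ k) φ.range := φ.rangeRestrict.toAlgebra
  have : IsScalarTower k (MvPolynomial σ k) L := .of_algebraMap_eq fun c => (φ.commutes c).symm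
  have : IsScalarTower k (MvPolynomial σ k) φ.range :=
    .of_algebraMap_eq fun c => (φ.rangeRestrict.commutes c).symm
  have : IsScalarTower (MvPolynomial σ k) φ.range L := .of_algebraMap_eq fun _ => rfl
  have : CharZero φ.range := charZero_of_injective_algebraMap (algebraMap k φ.range).injective
  have : Algebra.FormallySmooth φ.range L := formallySmooth_of_charZero
  have mkDerivation_eq (f : MvPolynomial σ k) : mkDerivation k v f = gradient y f ⬝ᵥ v := by
    have derivation_eq := derivation_aeval (mkDerivation k v) (X : σ → MvPolynomial σ k) f
    rw [aeval_X_left_apply] at derivation_eq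
    rw [derivation_eq]
    refine Finset.sum_congr rfl fun i _ => ?_
    rw [mkDerivation_X, Algebra.smul_def, gradient, aeval_X_left_apply]
    rfl
  obtain ⟨D', hD'⟩ := exists_derivation_of_surjective φ.rangeRestrict_surjective
    (mkDerivation k v) fun f hf => by
      rw [mkDerivation_eq]
      exact mem_perp_normalSpan.1 hv f (congrArg Subtype.val hf)
  obtain ⟨D, hD⟩ := exists_derivation_extension D'
  refine ⟨D, fun i => ?_⟩
  have y_eq : y i = algebraMap φ.range L (algebraMap (MvPolynomial σ k) φ.range (X i)) :=
    (aeval_X y i).symm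
  rw [y_eq, hD, hD', mkDerivation_X]

end NormalSpan

section GenericPoint

variable {k σ : Type*} [Field k]

/-- The function field of the variety of a prime ideal. -/
abbrev FunctionField (I : Ideal (MvPolynomial σ k)) : Type _ := FractionRing (MvPolynomial σ k ⧸ I)

/-- The generic point of the variety of a prime ideal. -/
def genericPoint (I : Ideal (MvPolynomial σ k)) : σ → FunctionField I :=
  fun i => algebraMap _ _ (Ideal.Quotient.mk I (X i))

variable (I : Ideal (MvPolynomial σ k))

theorem aeval_genericPoint (f : MvPolynomial σ k) :
    aeval (genericPoint I) f = algebraMap _ (FunctionField I) (Ideal.Quotient.mk I f) := by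
  have aeval_eq : (aeval (genericPoint I) : MvPolynomial σ k →ₐ[k] FunctionField I) =
      (IsScalarTower.toAlgHom k (MvPolynomial σ k ⧸ I) (FunctionField I)).comp
        (Ideal.Quotient.mkₐ k I) := by
    ext i
    simp [genericPoint]
  rw [aeval_eq]
  rfl

theorem aeval_genericPoint_eq_zero {f : MvPolynomial σ k} :
    aeval (genericPoint I) f = 0 ↔ f ∈ I := by
  rw [aeval_genericPoint, ← Ideal.Quotient.eq_zero_iff_mem]
  exact map_eq_zero_iff _ (IsFractionRing.injective _ _)

theorem ker_aeval_genericPoint :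
    RingHom.ker (aeval (genericPoint I) : MvPolynomial σ k →ₐ[k] FunctionField I) = I :=
  Ideal.ext fun _ => aeval_genericPoint_eq_zero I

variable [I.IsPrime]

theorem derivation_eq_zero_of_genericPoint [Finite σ]
    {D : Derivation k (FunctionField I) (FunctionField I)} (hD : D ∘ genericPoint I = 0) :
    D = 0 := by
  have := Fintype.ofFinite σ
  have D_algebraMap (a : MvPolynomial σ k ⧸ I) : D (algebraMap _ _ a) = 0 := by
    obtain ⟨f, rfl⟩ := Ideal.Quotient.mk_surjective a
    rw [← aeval_genericPoint, derivation_aeval]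
    exact Finset.sum_eq_zero fun i _ => by rw [show D (genericPoint I i) = 0 from congr_fun hD i,
      smul_zero]
  ext z
  obtain ⟨a, b, -, rfl⟩ := IsFractionRing.div_surjective (A := MvPolynomial σ k ⧸ I) z
  simp [Derivation.leibniz_div, D_algebraMap]

theorem finrank_perp_normalSpan_genericPoint [CharZero k] [Fintype σ] :
    Module.finrank (FunctionField I) (perp (normalSpan I (genericPoint I))) =
      Module.finrank (FunctionField I) (Derivation k (FunctionField I) (FunctionField I)) := by
  let velocity : Derivation k (FunctionField I) (FunctionField I) →ₗ[FunctionField I]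
      (σ → FunctionField I) :=
    { toFun := fun D => D ∘ genericPoint I
      map_add' := fun _ _ => rfl
      map_smul' := fun _ _ => rfl }
  have injective : Function.Injective velocity :=
    (injective_iff_map_eq_zero _).2 fun _ => derivation_eq_zero_of_genericPoint I
  have range_eq : LinearMap.range velocity = perp (normalSpan I (genericPoint I)) := by
    ext v
    constructor
    · rintro ⟨D, rfl⟩
      exact derivation_comp_mem_perp_normalSpan
        (fun f hf => (aeval_genericPoint_eq_zero I).2 hf) D
    · intro hv
      obtain ⟨D, hD⟩ : ∃ D : Derivation k (FunctionField I) (FunctionField I),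
          ∀ i, D (genericPoint I i) = v i :=
        exists_derivation_of_mem_perp_normalSpan (by rwa [ker_aeval_genericPoint I])
      exact ⟨D, funext hD⟩
  rw [← range_eq, LinearMap.finrank_range_of_inj injective]

theorem finrank_normalSpan_add_ringKrullDim [CharZero k] [Fintype σ] :
    (Module.finrank (FunctionField I) (normalSpan I (genericPoint I)) : WithBot ℕ∞) +
      ringKrullDim (MvPolynomial σ k ⧸ I) = Fintype.card σ := by
  obtain ⟨d, t, ht, hd⟩ :=
    exists_isTranscendenceBasis_ringKrullDim_eq k (MvPolynomial σ k ⧸ I) (FunctionField I)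
  rw [hd, ← finrank_add_finrank_perp (normalSpan I (genericPoint I)),
    finrank_perp_normalSpan_genericPoint, finrank_derivation_of_isTranscendenceBasis ht,
    Nat.card_fin, Nat.cast_add]

end GenericPoint

section KernelDimension

variable {k τ L : Type*} [Field k] [Field L] [Algebra k L]

theorem ringKrullDim_quotient_ker_aeval {ι : Type*} [Finite ι] [Finite τ] {t : ι → L}
    (ht : IsTranscendenceBasis k t) {z : τ → L}
    (hz : IntermediateField.adjoin k (Set.range z) = ⊤) :
    ringKrullDim (MvPolynomial τ k ⧸ RingHom.ker (aeval z : MvPolynomial τ k →ₐ[k] L)) =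
      Nat.card ι := by
  let φ : MvPolynomial τ k →ₐ[k] L := aeval z
  let : Algebra (MvPolynomial τ k ⧸ RingHom.ker φ) L := (Ideal.kerLiftAlg φ).toAlgebra
  have : IsScalarTower k (MvPolynomial τ k ⧸ RingHom.ker φ) L :=
    .of_algebraMap_eq fun a => ((Ideal.kerLiftAlg φ).commutes a).symm
  have : FaithfulSMul (MvPolynomial τ k ⧸ RingHom.ker φ) L :=
    (faithfulSMul_iff_algebraMap_injective _ _).2 (Ideal.kerLiftAlg_injective φ)
  have : (RingHom.ker φ).IsPrime := RingHom.ker_isPrime _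
  have : IsFractionRing (MvPolynomial τ k ⧸ RingHom.ker φ) L := .of_field _ _ fun a => by
    obtain ⟨f, g, rfl⟩ := (IntermediateField.mem_adjoin_range_iff k z a).1
      (hz ▸ IntermediateField.mem_top)
    exact ⟨Ideal.Quotient.mk _ f, Ideal.Quotient.mk _ g, rfl⟩
  obtain ⟨d, s, hs, hd⟩ :=
    exists_isTranscendenceBasis_ringKrullDim_eq k (MvPolynomial τ k ⧸ RingHom.ker φ) L
  have card_eq : d = Nat.card ι := by
    simpa [Nat.card] using congrArg Cardinal.toNat (hs.lift_cardinalMk_eq ht)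
  rw [← card_eq]
  exact hd

theorem eq_of_le_of_ringKrullDim_quotient_le {R : Type*} [CommRing R] {I J : Ideal R}
    [I.IsPrime] (hIJ : I ≤ J) {d : ℕ} (hd : ringKrullDim (R ⧸ I) ≤ d)
    (hdJ : d ≤ ringKrullDim (R ⧸ J)) : I = J := by
  refine hIJ.antisymm fun a haJ => ?_
  by_contra haI
  have mk_mem : Ideal.Quotient.mk I a ∈ nonZeroDivisors (R ⧸ I) :=
    mem_nonZeroDivisors_of_ne_zero (mt Ideal.Quotient.eq_zero_iff_mem.1 haI)
  have surjective : Function.Surjective (Ideal.Quotient.lift (Ideal.span {Ideal.Quotient.mk I a})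
      (Ideal.Quotient.factor hIJ) fun b hb => by
        obtain ⟨c, rfl⟩ := Ideal.mem_span_singleton'.1 hb
        simp [Ideal.Quotient.eq_zero_iff_mem.2 haJ]) :=
    Ideal.Quotient.lift_surjective_of_surjective _ _ (Ideal.Quotient.factor_surjective hIJ)
  have succ_le : (d : WithBot ℕ∞) + 1 ≤ d :=
    calc (d : WithBot ℕ∞) + 1 ≤ ringKrullDim ((R ⧸ I) ⧸ Ideal.span {Ideal.Quotient.mk I a}) + 1 :=
          add_le_add_left (hdJ.trans (ringKrullDim_le_of_surjective _ surjective)) 1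
      _ ≤ ringKrullDim (R ⧸ I) := ringKrullDim_quotient_succ_le_of_nonZeroDivisor mk_mem
      _ ≤ d := hd
  norm_cast at succ_le
  omega

theorem adjoin_range_genericPoint (I : Ideal (MvPolynomial τ k)) [I.IsPrime] :
    IntermediateField.adjoin k (Set.range (genericPoint I)) = ⊤ := by
  refine eq_top_iff.2 fun a _ => (IntermediateField.mem_adjoin_range_iff k _ a).2 ?_
  obtain ⟨f, g, -, rfl⟩ := IsFractionRing.div_surjective (A := MvPolynomial τ k ⧸ I) a
  obtain ⟨f, rfl⟩ := Ideal.Quotient.mk_surjective f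
  obtain ⟨g, rfl⟩ := Ideal.Quotient.mk_surjective g
  exact ⟨f, g, by rw [aeval_genericPoint, aeval_genericPoint]⟩

end KernelDimension

section ConormalCone

variable {k σ : Type*} [Field k]

/-- The affine version of the conormal variety: the pairs of a point of `V` and a combination of
gradients at this point of equations of `V`. The singular points of `V` are not excluded, which
does not change the Zariski closure. -/
def conormalCone (V : Set (σ → k)) : Set (σ ⊕ σ → k) :=
  {z | z ∘ Sum.inl ∈ V ∧ z ∘ Sum.inr ∈ normalSpan (vanishingIdeal k V) (z ∘ Sum.inl)}

/-- The ideal of the conormal variety. -/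
def conormalIdeal (V : Set (σ → k)) : Ideal (MvPolynomial (σ ⊕ σ) k) :=
  vanishingIdeal k (conormalCone V)

theorem mem_conormalCone {V : Set (σ → k)} {p q : σ → k} :
    Sum.elim p q ∈ conormalCone V ↔ p ∈ V ∧ q ∈ normalSpan (vanishingIdeal k V) p :=
  Iff.rfl

theorem rename_inl_mem_conormalIdeal {V : Set (σ → k)} {f : MvPolynomial σ k} :
    rename Sum.inl f ∈ conormalIdeal V ↔ f ∈ vanishingIdeal k V := by
  simp only [conormalIdeal, mem_vanishingIdeal_iff, aeval_rename]
  exact ⟨fun h v hv => h (Sum.elim v 0) (mem_conormalCone.2 ⟨hv, Submodule.zero_mem _⟩),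
    fun h z hz => h _ hz.1⟩

theorem aeval_aeval {ι τ E : Type*} [CommRing E] [Algebra k E] (y : τ → E)
    (g : ι → MvPolynomial τ k) (f : MvPolynomial ι k) :
    aeval y (aeval g f) = aeval (fun i => aeval y (g i)) f :=
  comp_aeval_apply g (aeval y) f

theorem aeval_sumElim {ι E : Type*} [CommRing E] [Algebra k E] (c : ι → E) (y : σ → E)
    (F : MvPolynomial (ι ⊕ σ) k) :
    aeval (Sum.elim c y) F =
      eval₂ (aeval y : MvPolynomial σ k →ₐ[k] E).toRingHom c (sumAlgEquiv k ι σ F) := by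
  induction F using MvPolynomial.induction_on with
  | C a => simp [MvPolynomial.algHom_C]
  | add F G hF hG => rw [map_add, map_add, eval₂_add, hF, hG]
  | mul_X F i hF =>
    rw [map_mul, map_mul, eval₂_mul, hF]
    cases i <;> simp

theorem aeval_sumElim_eq_zero [Infinite k] {ι E : Type*} [CommRing E] [Algebra k E]
    {V : Set (σ → k)} {F : MvPolynomial (ι ⊕ σ) k}
    (hF : ∀ t : ι → k, ∀ v ∈ V, aeval (Sum.elim t v) F = 0) (c : ι → E) {y : σ → E}
    (hy : ∀ f ∈ vanishingIdeal k V, aeval y f = 0) : aeval (Sum.elim c y) F = 0 := by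
  have coeff_mem (m : ι →₀ ℕ) : coeff m (sumAlgEquiv k ι σ F) ∈ vanishingIdeal k V := by
    refine mem_vanishingIdeal_iff.2 fun v hv => ?_
    have map_eq_zero :
        map (aeval v : MvPolynomial σ k →ₐ[k] k).toRingHom (sumAlgEquiv k ι σ F) = 0 :=
      MvPolynomial.funext fun t => by rw [eval_map, ← aeval_sumElim, hF t v hv, map_zero]
    exact (coeff_map _ _ m).symm.trans (by rw [map_eq_zero, coeff_zero])
  rw [aeval_sumElim, eval₂_eq]
  exact Finset.sum_eq_zero fun m _ => by
    rw [AlgHom.toRingHom_eq_coe, RingHom.coe_coe, hy _ (coeff_mem m), zero_mul]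

/-- The universal pair of a point and a combination of the gradients of the `h j` at this point:
its coordinates are polynomials in the coefficients of the combination and the coordinates of the
point. -/
def conormalFamily {ι : Type*} [Fintype ι] (h : ι → MvPolynomial σ k) :
    σ ⊕ σ → MvPolynomial (ι ⊕ σ) k :=
  Sum.elim (fun i => X (Sum.inr i)) fun i => ∑ j, X (Sum.inl j) * rename Sum.inr (pderiv i (h j))

theorem aeval_conormalFamily {ι E : Type*} [Fintype ι] [CommRing E] [Algebra k E]
    (h : ι → MvPolynomial σ k) (c : ι → E) (y : σ → E) (F : MvPolynomial (σ ⊕ σ) k) :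
    aeval (Sum.elim c y) (aeval (conormalFamily h) F) =
      aeval (Sum.elim y (∑ j, c j • gradient y (h j))) F := by
  rw [aeval_aeval]
  congr 2
  ext i
  cases i <;> simp [conormalFamily, gradient, aeval_rename]

theorem aeval_conormalFamily_C {ι E : Type*} [Fintype ι] [CommRing E] [Algebra k E]
    (h : ι → MvPolynomial σ k) (c : ι → k) (y : σ → E) (F : MvPolynomial (σ ⊕ σ) k) :
    aeval y (aeval (Sum.elim (C ∘ c) X) (aeval (conormalFamily h) F)) =
      aeval (Sum.elim y (∑ j, algebraMap k E (c j) • gradient y (h j))) F := by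
  rw [aeval_aeval, ← aeval_conormalFamily]
  congr 2
  ext i
  cases i <;> simp

theorem aeval_eq_zero_of_mem_conormalIdeal [Infinite k] {V : Set (σ → k)}
    {F : MvPolynomial (σ ⊕ σ) k} (hF : F ∈ conormalIdeal V) {E : Type*} [CommRing E] [Algebra k E]
    {y z : σ → E} (hy : ∀ f ∈ vanishingIdeal k V, aeval y f = 0)
    (hz : z ∈ normalSpan (vanishingIdeal k V) y) : aeval (Sum.elim y z) F = 0 := by
  obtain ⟨n, c, h, hI, rfl⟩ := mem_normalSpan_iff.1 hz
  rw [← aeval_conormalFamily]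
  refine aeval_sumElim_eq_zero (fun t v hv => ?_) c hy
  rw [aeval_conormalFamily]
  exact mem_vanishingIdeal_iff.1 hF _
    (mem_conormalCone.2 ⟨hv, mem_normalSpan_iff.2 ⟨n, t, h, hI, rfl⟩⟩)

theorem mem_conormalIdeal_iff [Infinite k] {V : Set (σ → k)} {F : MvPolynomial (σ ⊕ σ) k} :
    F ∈ conormalIdeal V ↔
      ∀ w ∈ normalSpan (vanishingIdeal k V) (genericPoint (vanishingIdeal k V)),
        aeval (Sum.elim (genericPoint (vanishingIdeal k V)) w) F = 0 := by
  refine ⟨fun hF w hw => aeval_eq_zero_of_mem_conormalIdeal hF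
    (fun f hf => (aeval_genericPoint_eq_zero _).2 hf) hw, fun hF => ?_⟩
  refine mem_vanishingIdeal_iff.2 fun z ⟨hp, hq⟩ => ?_
  obtain ⟨n, c, h, hI, q_eq⟩ := mem_normalSpan_iff.1 hq
  have mem : aeval (Sum.elim (C ∘ c) X) (aeval (conormalFamily h) F) ∈ vanishingIdeal k V := by
    rw [← aeval_genericPoint_eq_zero, aeval_conormalFamily_C]
    exact hF _ (mem_normalSpan_iff.2 ⟨n, _, h, hI, rfl⟩)
  have vanishes := mem_vanishingIdeal_iff.1 mem _ hp
  rw [aeval_conormalFamily_C] at vanishes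
  rw [← Sum.elim_comp_inl_inr z, q_eq]
  exact vanishes

end ConormalCone

section GenericConormalVector

open scoped Matrix

variable {k σ ι : Type*} [Field k]

theorem exists_basis_gradients [CharZero k] [Fintype σ] (I : Ideal (MvPolynomial σ k)) [I.IsPrime]
    {f : ι → MvPolynomial σ k}
    (hf : Submodule.span (FunctionField I) (Set.range fun j => gradient (genericPoint I) (f j)) =
      normalSpan I (genericPoint I)) :
    ∃ (r : ℕ) (a : Fin r → ι), ringKrullDim (MvPolynomial σ k ⧸ I) + r = Fintype.card σ ∧
      LinearIndependent (FunctionField I) (fun j => gradient (genericPoint I) (f (a j))) ∧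
      Submodule.span (FunctionField I) (Set.range fun j => gradient (genericPoint I) (f (a j))) =
        normalSpan I (genericPoint I) := by
  obtain ⟨b, hb, span_eq, linearIndependent⟩ :=
    Submodule.exists_fun_fin_finrank_span_eq (FunctionField I)
      (Set.range fun j => gradient (genericPoint I) (f j))
  choose a ha using hb
  obtain rfl : (fun j => gradient (genericPoint I) (f (a j))) = b := funext ha
  refine ⟨_, a, ?_, linearIndependent, span_eq.trans hf⟩
  rw [hf, add_comm]
  exact finrank_normalSpan_add_ringKrullDim I

variable {K : Type*} [Field K] [Algebra k K]

/-- The combination, with indeterminate coefficients, of the gradients of the `h j` at `x`,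
paired with the point `x`. -/
def genericConormalVector [Fintype ι] (x : σ → K) (h : ι → MvPolynomial σ k) :
    σ ⊕ σ → MvPolynomial ι K :=
  Sum.elim (C ∘ x) fun i => ∑ j, X j * C (gradient x (h j) i)

theorem aeval_genericConormalVector [Fintype ι] (x : σ → K) (h : ι → MvPolynomial σ k)
    (c : ι → K) (F : MvPolynomial (σ ⊕ σ) k) :
    aeval c (aeval (genericConormalVector x h) F) =
      aeval (Sum.elim x (∑ j, c j • gradient x (h j))) F := by
  have comp_aeval := comp_aeval_apply (genericConormalVector x h)
    ((aeval c : MvPolynomial ι K →ₐ[K] K).restrictScalars k) F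
  refine comp_aeval.trans ?_
  congr 2
  ext i
  cases i <;> simp [genericConormalVector]

theorem ker_aeval_genericConormalVector [Infinite k] [Fintype ι] {V : Set (σ → k)}
    {h : ι → MvPolynomial σ k} (hI : ∀ j, h j ∈ vanishingIdeal k V)
    [(vanishingIdeal k V).IsPrime]
    (hspan : Submodule.span _ (Set.range fun j => gradient (genericPoint (vanishingIdeal k V))
      (h j)) = normalSpan (vanishingIdeal k V) (genericPoint (vanishingIdeal k V))) :
    RingHom.ker (aeval (genericConormalVector (genericPoint (vanishingIdeal k V)) h) :
      MvPolynomial (σ ⊕ σ) k →ₐ[k] _) = conormalIdeal V := by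
  set I := vanishingIdeal k V
  have infinite : Infinite (FunctionField I) := .of_injective _ (algebraMap k _).injective
  ext F
  rw [RingHom.mem_ker]
  refine ⟨fun hF => mem_conormalIdeal_iff.2 fun w hw => ?_, fun hF => ?_⟩
  · rw [← hspan, Submodule.mem_span_range_iff_exists_fun] at hw
    obtain ⟨c, rfl⟩ := hw
    rw [← aeval_genericConormalVector, hF, map_zero]
  · refine MvPolynomial.funext fun c => ?_
    rw [map_zero, ← coe_aeval_eq_eval, RingHom.coe_coe, aeval_genericConormalVector]
    exact mem_conormalIdeal_iff.1 hF _ (Submodule.sum_mem _ fun j _ =>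
      Submodule.smul_mem _ _ (gradient_mem_normalSpan _ (hI j)))

theorem intermediateField_eq_top_of_X_mem
    {S : IntermediateField k (FractionRing (MvPolynomial ι K))}
    (hK : ∀ a : K, algebraMap K (FractionRing (MvPolynomial ι K)) a ∈ S)
    (hX : ∀ j, algebraMap (MvPolynomial ι K) (FractionRing (MvPolynomial ι K)) (X j) ∈ S) :
    S = ⊤ := by
  have polynomial_mem (F : MvPolynomial ι K) :
      algebraMap _ (FractionRing (MvPolynomial ι K)) F ∈ S := by
    induction F using MvPolynomial.induction_on with
    | C a => exact hK a
    | add F G hF hG => rw [map_add]; exact add_mem hF hG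
    | mul_X F j hF => rw [map_mul]; exact mul_mem hF (hX j)
  refine eq_top_iff.2 fun a _ => ?_
  obtain ⟨F, G, -, rfl⟩ := IsFractionRing.div_surjective (A := MvPolynomial ι K) a
  exact div_mem (polynomial_mem F) (polynomial_mem G)

theorem adjoin_range_genericConormalVector [Finite σ] {r : ℕ} {x : σ → K}
    (hx : IntermediateField.adjoin k (Set.range x) = ⊤) {h : Fin r → MvPolynomial σ k}
    (hli : LinearIndependent K fun j => gradient x (h j)) :
    IntermediateField.adjoin k (Set.range (algebraMap (MvPolynomial (Fin r) K)
      (FractionRing (MvPolynomial (Fin r) K)) ∘ genericConormalVector x h)) = ⊤ := by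
  set L := FractionRing (MvPolynomial (Fin r) K)
  set z : σ ⊕ σ → L := algebraMap (MvPolynomial (Fin r) K) L ∘ genericConormalVector x h
  set S := IntermediateField.adjoin k (Set.range z)
  have algebraMap_mem (a : K) : algebraMap K L a ∈ S := by
    have le_comap : IntermediateField.adjoin k (Set.range x) ≤
        S.comap (IsScalarTower.toAlgHom k K L) := by
      rw [IntermediateField.adjoin_le_iff]
      rintro _ ⟨i, rfl⟩
      exact IntermediateField.subset_adjoin _ _
        ⟨Sum.inl i, (IsScalarTower.algebraMap_apply K (MvPolynomial (Fin r) K) L _).symm⟩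
    exact le_comap (hx ▸ IntermediateField.mem_top)
  have X_mem (j : Fin r) : algebraMap (MvPolynomial (Fin r) K) L (X j) ∈ S := by
    obtain ⟨s, hs⟩ := exists_submatrix_det_ne_zero (M := Matrix.of fun j => gradient x (h j)) hli
    set A := (Matrix.of fun j => gradient x (h j)).submatrix id s
    have X_eq : (X : Fin r → MvPolynomial (Fin r) K) =
        (fun j => ∑ l, X l * C (A l j)) ᵥ* (A⁻¹).map C := by
      have eq_vecMul : (fun j => ∑ l, X l * C (A l j)) =
          (X : Fin r → MvPolynomial (Fin r) K) ᵥ* A.map C := rfl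
      rw [eq_vecMul, Matrix.vecMul_vecMul, ← Matrix.map_mul, Matrix.mul_nonsing_inv _ hs.isUnit,
        Matrix.map_one _ C_0 C_1, Matrix.vecMul_one]
    rw [X_eq, Matrix.vecMul, dotProduct, map_sum]
    refine sum_mem fun l _ => ?_
    rw [map_mul]
    refine mul_mem (IntermediateField.subset_adjoin _ _ ⟨Sum.inr (s l), rfl⟩) ?_
    exact IsScalarTower.algebraMap_apply K (MvPolynomial (Fin r) K) L _ ▸ algebraMap_mem _
  exact intermediateField_eq_top_of_X_mem algebraMap_mem X_mem

end GenericConormalVector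

section GenericConormalPoint

universe u v

variable {k : Type u} {σ : Type v} [Field k] [CharZero k] (V : Set (σ → k))
  [(vanishingIdeal k V).IsPrime]

theorem exists_ker_aeval_genericConormalVector_eq [Fintype σ] :
    ∃ (r : ℕ) (h : Fin r → MvPolynomial σ k), (∀ j, h j ∈ vanishingIdeal k V) ∧
      ringKrullDim (MvPolynomial σ k ⧸ vanishingIdeal k V) + r = Fintype.card σ ∧
      LinearIndependent (FunctionField (vanishingIdeal k V))
        (fun j => gradient (genericPoint (vanishingIdeal k V)) (h j)) ∧
      RingHom.ker (aeval (genericConormalVector (genericPoint (vanishingIdeal k V)) h) :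
        MvPolynomial (σ ⊕ σ) k →ₐ[k] _) = conormalIdeal V := by
  have span_eq : Submodule.span (FunctionField (vanishingIdeal k V))
      (Set.range fun f : vanishingIdeal k V => gradient (genericPoint (vanishingIdeal k V)) f.1) =
      normalSpan (vanishingIdeal k V) (genericPoint (vanishingIdeal k V)) := by
    rw [normalSpan, Set.image_eq_range]
    rfl
  obtain ⟨r, a, hr, linearIndependent, span_eq⟩ := exists_basis_gradients _ span_eq
  exact ⟨r, fun j => a j, fun j => (a j).2, hr, linearIndependent,
    ker_aeval_genericConormalVector (fun j => (a j).2) span_eq⟩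

theorem isPrime_conormalIdeal [Finite σ] : (conormalIdeal V).IsPrime := by
  have := Fintype.ofFinite σ
  obtain ⟨r, h, -, -, -, ker_eq⟩ := exists_ker_aeval_genericConormalVector_eq V
  exact ker_eq ▸ RingHom.ker_isPrime _

theorem ker_aeval_algebraMap_comp {K A L τ : Type*} [Field K] [CommRing A] [IsDomain A]
    [Algebra K A] [Field L] [Algebra K L] [Algebra A L] [IsScalarTower K A L] [FaithfulSMul A L]
    (y : τ → A) : RingHom.ker (aeval (algebraMap A L ∘ y) : MvPolynomial τ K →ₐ[K] L) =
      RingHom.ker (aeval y : MvPolynomial τ K →ₐ[K] A) := by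
  ext F
  have comp_aeval : algebraMap A L (aeval y F) = aeval (algebraMap A L ∘ y) F :=
    comp_aeval_apply y (IsScalarTower.toAlgHom K A L) F
  rw [RingHom.mem_ker, RingHom.mem_ker, ← comp_aeval,
    map_eq_zero_iff _ (FaithfulSMul.algebraMap_injective A L)]

theorem ringKrullDim_quotient_conormalIdeal [Fintype σ] :
    ringKrullDim (MvPolynomial (σ ⊕ σ) k ⧸ conormalIdeal V) = Fintype.card σ := by
  set I := vanishingIdeal k V
  obtain ⟨r, h, -, hr, linearIndependent, ker_eq⟩ := exists_ker_aeval_genericConormalVector_eq V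
  obtain ⟨d, t, ht, hd⟩ :=
    exists_isTranscendenceBasis_ringKrullDim_eq k (MvPolynomial σ k ⧸ I) (FunctionField I)
  let L := FractionRing (MvPolynomial (Fin r) (FunctionField I))
  have : Algebra.IsAlgebraic (MvPolynomial (Fin r) (FunctionField I)) L :=
    (IsFractionRing.comap_isAlgebraic_iff (K := L) (C := L)).2 inferInstance
  have basis := ht.sumElim_comp
    ((IsTranscendenceBasis.mvPolynomial (Fin r) (FunctionField I)).algebraMap_comp (A := L))
  have dim_eq := ringKrullDim_quotient_ker_aeval basis
    (adjoin_range_genericConormalVector (adjoin_range_genericPoint I) linearIndependent)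
  rw [ker_aeval_algebraMap_comp, ker_eq] at dim_eq
  rw [dim_eq, ← hr, hd]
  simp [add_comm]

theorem exists_generic_conormal_vector [Finite σ] :
    ∃ (L : Type (max u v)) (_ : Field L) (_ : Algebra k L) (p q : σ → L),
      RingHom.ker (aeval (Sum.elim p q) : MvPolynomial (σ ⊕ σ) k →ₐ[k] L) = conormalIdeal V ∧
        q ∈ normalSpan (vanishingIdeal k V) p := by
  have := Fintype.ofFinite σ
  set I := vanishingIdeal k V
  obtain ⟨r, h, hI, -, -, ker_eq⟩ := exists_ker_aeval_genericConormalVector_eq V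
  let A := MvPolynomial (Fin r) (FunctionField I)
  refine ⟨FractionRing A, inferInstance, inferInstance,
    algebraMap A (FractionRing A) ∘ C ∘ genericPoint I,
    algebraMap A (FractionRing A) ∘ fun i => ∑ j, X j * C (gradient (genericPoint I) (h j) i),
    ?_, ?_⟩
  · rw [← ker_eq, ← ker_aeval_algebraMap_comp (A := A) (L := FractionRing A), genericConormalVector,
      Sum.comp_elim]
  · refine comp_mem_normalSpan (IsScalarTower.toAlgHom k A (FractionRing A))
      (mem_normalSpan_iff.2 ⟨r, X, h, hI, ?_⟩)
    ext1 i
    rw [Finset.sum_apply]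
    refine Finset.sum_congr rfl fun j _ => congrArg (X j * ·) ?_
    exact congr_fun (comp_gradient (IsScalarTower.toAlgHom k (FunctionField I) A)
      (genericPoint I) (h j)) i

end GenericConormalPoint

section Reflexivity

variable {k σ : Type*} [Field k]

/-- Irreducible cones in affine space, the algebraic side of irreducible projective varieties. -/
structure IsIrreducibleCone (V : Set (σ → k)) : Prop where
  smul_mem : ∀ (t : k), ∀ v ∈ V, t • v ∈ V
  prime : (vanishingIdeal k V).IsPrime

/-- Euler's relation, obtained by differentiating `f (t v) = 0` with respect to `t` at `t = 1`. -/
theorem IsIrreducibleCone.sum_X_mul_pderiv_mem [Infinite k] [Fintype σ] {V : Set (σ → k)}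
    (hV : IsIrreducibleCone V) {f : MvPolynomial σ k} (hf : f ∈ vanishingIdeal k V) :
    ∑ i, X i * pderiv i f ∈ vanishingIdeal k V := by
  refine mem_vanishingIdeal_iff.2 fun v hv => ?_
  let line : σ → Polynomial k := fun i => Polynomial.X * Polynomial.C (v i)
  have aeval_line_comp (t : k) : Polynomial.aeval t ∘ line = t • v := by
    ext i
    simp [line, mul_comm (v i)]
  have aeval_line : aeval line f = 0 := Polynomial.funext fun t => by
    have comp_eq := comp_aeval_apply line (Polynomial.aeval t) f
    rw [← Polynomial.coe_aeval_eq_eval, map_zero]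
    exact comp_eq.trans <| (congrArg (aeval · f) (aeval_line_comp t)).trans
      (mem_vanishingIdeal_iff.1 hf _ (hV.smul_mem t v hv))
  have derivative_eq := derivation_aeval (Polynomial.derivative' (R := k)) line f
  rw [aeval_line, Derivation.map_zero] at derivative_eq
  have at_one := congrArg (Polynomial.aeval (1 : k)) derivative_eq
  rw [map_zero, map_sum] at at_one
  rw [map_sum, at_one]
  refine Finset.sum_congr rfl fun i _ => ?_
  have gradient_eq := congr_fun (comp_gradient (Polynomial.aeval (1 : k)) line f) i
  rw [aeval_line_comp, one_smul] at gradient_eq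
  rw [smul_eq_mul, map_mul, map_mul, aeval_X, mul_comm]
  refine congrArg₂ (· * ·) gradient_eq.symm ?_
  simp [line, Polynomial.derivative']

theorem IsIrreducibleCone.mem_perp_normalSpan [Infinite k] [Fintype σ] {V : Set (σ → k)}
    (hV : IsIrreducibleCone V) {E : Type*} [CommRing E] [Algebra k E] {y : σ → E}
    (hy : ∀ f ∈ vanishingIdeal k V, aeval y f = 0) : y ∈ perp (normalSpan (vanishingIdeal k V) y) :=
  DualMLE.mem_perp_normalSpan.2 fun f hf => by
    have euler := hy _ (hV.sum_X_mul_pderiv_mem hf)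
    simp only [map_sum, map_mul, aeval_X] at euler
    rw [dotProduct_comm]
    exact euler

theorem dotProduct_derivation_eq_zero [Fintype σ] {L : Type*} [Field L] [Algebra k L]
    {p q : σ → L} (D : Derivation k L L) (hpq : q ⬝ᵥ p = 0) (hD : q ⬝ᵥ (D ∘ p) = 0) :
    (D ∘ q) ⬝ᵥ p = 0 := by
  have leibniz := congrArg D hpq
  simp only [dotProduct, map_sum, D.leibniz, smul_eq_mul, Finset.sum_add_distrib, map_zero]
    at leibniz
  rw [show ∑ i, q i * D (p i) = 0 from hD, zero_add] at leibniz
  rw [dotProduct_comm]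
  exact leibniz

variable [CharZero k] {V V' : Set (σ → k)}

theorem rename_swap_comap_conormalIdeal_le [Finite σ] (hV : IsIrreducibleCone V)
    (hdual : vanishingIdeal k V' = (conormalIdeal V).comap (rename Sum.inr)) :
    (conormalIdeal V').comap (rename Sum.swap) ≤ conormalIdeal V := by
  have := Fintype.ofFinite σ
  have := hV.prime
  obtain ⟨L, _, _, p, q, ker_eq, q_mem⟩ := exists_generic_conormal_vector V
  have p_vanishes (f) (hf : f ∈ vanishingIdeal k V) : aeval p f = 0 := by
    have mem := rename_inl_mem_conormalIdeal.2 hf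
    rwa [← ker_eq, RingHom.mem_ker, aeval_rename, Sum.elim_comp_inl] at mem
  have ker_aeval_q : RingHom.ker (aeval q : MvPolynomial σ k →ₐ[k] L) = vanishingIdeal k V' := by
    ext f
    rw [hdual, Ideal.mem_comap, ← ker_eq, RingHom.mem_ker, RingHom.mem_ker, aeval_rename,
      Sum.elim_comp_inr]
  have p_mem : p ∈ normalSpan (vanishingIdeal k V') q := by
    rw [← perp_perp (normalSpan _ q)]
    intro v hv
    rw [← ker_aeval_q] at hv
    obtain ⟨D, hD⟩ := exists_derivation_of_mem_perp_normalSpan hv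
    obtain rfl : D ∘ q = v := funext hD
    exact dotProduct_derivation_eq_zero D (hV.mem_perp_normalSpan p_vanishes q q_mem)
      (derivation_comp_mem_perp_normalSpan p_vanishes D q q_mem)
  intro F hF
  have vanishes := aeval_eq_zero_of_mem_conormalIdeal (Ideal.mem_comap.1 hF)
    (fun f hf => by rwa [← ker_aeval_q] at hf) p_mem
  rwa [aeval_rename, Sum.elim_swap, ← RingHom.mem_ker, ker_eq] at vanishes

theorem ringKrullDim_quotient_comap {R S : Type*} [CommRing R] [CommRing S] (e : R ≃+* S)
    (J : Ideal S) : ringKrullDim (R ⧸ J.comap e) = ringKrullDim (S ⧸ J) :=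
  ringKrullDim_eq_of_ringEquiv
    (Ideal.quotientEquiv _ _ e (Ideal.map_comap_eq_self_of_equiv e J).symm)

/-- Reflexivity: one inclusion suffices, because both conormal varieties have the dimension of
the ambient affine space. -/
theorem rename_swap_mem_conormalIdeal_iff [Finite σ] (hV : IsIrreducibleCone V)
    (hV' : (vanishingIdeal k V').IsPrime)
    (hdual : vanishingIdeal k V' = (conormalIdeal V).comap (rename Sum.inr))
    (F : MvPolynomial (σ ⊕ σ) k) :
    rename Sum.swap F ∈ conormalIdeal V' ↔ F ∈ conormalIdeal V := by
  have := Fintype.ofFinite σ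
  have := hV.prime
  have := isPrime_conormalIdeal V'
  have dim_comap : ringKrullDim (MvPolynomial (σ ⊕ σ) k ⧸
      (conormalIdeal V').comap (rename Sum.swap : MvPolynomial (σ ⊕ σ) k →ₐ[k] _)) =
      Fintype.card σ :=
    (ringKrullDim_quotient_comap (renameEquiv k (Equiv.sumComm σ σ)).toRingEquiv _).trans
      (ringKrullDim_quotient_conormalIdeal V')
  have comap_eq := eq_of_le_of_ringKrullDim_quotient_le
    (rename_swap_comap_conormalIdeal_le hV hdual) dim_comap.le
    (ringKrullDim_quotient_conormalIdeal V).ge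
  rw [← comap_eq]
  rfl

end Reflexivity

section Minors

open scoped Matrix

variable {r : ℕ} {σ : Type*}

/-- The amount by which a vector `z` fails the relation that Cramer's rule, applied to the columns
selected by `s`, gives for the combinations of the rows of `M`. -/
def cramerDefect {R : Type*} [CommRing R] (M : Matrix (Fin r) σ R) (s : Fin r → σ) (z : σ → R) :
    σ → R :=
  (M.submatrix id s).det • z - ((z ∘ s) ᵥ* (M.submatrix id s).adjugate) ᵥ* M

theorem comp_cramerDefect {R S : Type*} [CommRing R] [CommRing S] (φ : R →+* S)
    (M : Matrix (Fin r) σ R) (s : Fin r → σ) (z : σ → R) :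
    φ ∘ cramerDefect M s z = cramerDefect (M.map φ) s (φ ∘ z) := by
  have vecMul_map (v : Fin r → R) : φ ∘ (v ᵥ* M) = (φ ∘ v) ᵥ* M.map φ :=
    _root_.funext fun i => φ.map_vecMul M v i
  have det_map : φ (M.submatrix id s).det = ((M.map φ).submatrix id s).det := φ.map_det _
  have adjugate_map :
      (M.submatrix id s).adjugate.map φ = ((M.map φ).submatrix id s).adjugate := φ.map_adjugate _
  have coefficients_map : φ ∘ ((z ∘ s) ᵥ* (M.submatrix id s).adjugate) =
      ((φ ∘ z) ∘ s) ᵥ* ((M.map φ).submatrix id s).adjugate := by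
    rw [← adjugate_map]
    exact _root_.funext fun j => φ.map_vecMul _ _ j
  rw [cramerDefect, cramerDefect, ← det_map, ← coefficients_map, ← vecMul_map]
  ext i
  exact (map_sub φ _ _).trans (congrArg (· - _) (map_mul φ _ _))

theorem cramerDefect_eq_zero {R : Type*} [CommRing R] {M : Matrix (Fin r) σ R} (s : Fin r → σ)
    {z : σ → R} (hz : z ∈ Submodule.span R (Set.range M.row)) : cramerDefect M s z = 0 := by
  obtain ⟨c, hc⟩ := (Submodule.mem_span_range_iff_exists_fun R).1 hz
  refine sub_eq_zero.2 (det_smul_eq_vecMul_adjugate_vecMul M s (c := c) ?_)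
  rw [Matrix.vecMul_eq_sum, ← hc]
  rfl

theorem mem_span_of_cramerDefect_eq_zero {K : Type*} [Field K] {M : Matrix (Fin r) σ K}
    {s : Fin r → σ} {z : σ → K} (hM : (M.submatrix id s).det ≠ 0) (hz : cramerDefect M s z = 0) :
    z ∈ Submodule.span K (Set.range M.row) := by
  rw [← Submodule.smul_mem_iff _ hM, sub_eq_zero.1 hz]
  exact range_vecMulLinear M ▸ LinearMap.mem_range_self M.vecMulLinear _

variable {k : Type*} [Field k]

/-- The Jacobian matrix of a family of polynomials, one row for each polynomial. -/
def jacobian (h : Fin r → MvPolynomial σ k) : Matrix (Fin r) σ (MvPolynomial σ k) :=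
  Matrix.of fun j i => pderiv i (h j)

/-- The maximal minor of the Jacobian matrix of the `h j` on the columns selected by `s`. -/
def jacobianMinor (h : Fin r → MvPolynomial σ k) (s : Fin r → σ) : MvPolynomial σ k :=
  ((jacobian h).submatrix id s).det

variable {h : Fin r → MvPolynomial σ k} {s : Fin r → σ}

theorem aeval_jacobianMinor {E : Type*} [CommRing E] [Algebra k E] (y : σ → E) :
    aeval y (jacobianMinor h s) =
      ((Matrix.of fun j => gradient y (h j)).submatrix id s).det := by
  rw [jacobianMinor, AlgHom.map_det]
  rfl

theorem linearIndependent_of_aeval_jacobianMinor {E : Type*} [Field E] [Algebra k E] {y : σ → E}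
    (hy : aeval y (jacobianMinor h s) ≠ 0) : LinearIndependent E fun j => gradient y (h j) := by
  rw [aeval_jacobianMinor, ← isUnit_iff_ne_zero, ← Matrix.isUnit_iff_isUnit_det,
    ← Matrix.linearIndependent_rows_iff_isUnit] at hy
  exact .of_comp (LinearMap.funLeft E E s) hy

theorem exists_jacobianMinor_notMem [Finite σ] (I : Ideal (MvPolynomial σ k)) [I.IsPrime]
    (hli : LinearIndependent (FunctionField I) fun j => gradient (genericPoint I) (h j)) :
    ∃ s, jacobianMinor h s ∉ I := by
  obtain ⟨s, hs⟩ :=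
    exists_submatrix_det_ne_zero (M := Matrix.of fun j => gradient (genericPoint I) (h j)) hli
  refine ⟨s, fun hI => hs ?_⟩
  rw [← aeval_jacobianMinor, aeval_genericPoint_eq_zero]
  exact hI

/-- The equations that Cramer's rule gives for the second point of a pair to be a combination of
the gradients of the `h j` at the first one. -/
def cramerRelation (h : Fin r → MvPolynomial σ k) (s : Fin r → σ) : σ → MvPolynomial (σ ⊕ σ) k :=
  cramerDefect ((jacobian h).map (rename Sum.inl : MvPolynomial σ k →ₐ[k] _)) s (X ∘ Sum.inr)

theorem aeval_comp_cramerRelation {E : Type*} [CommRing E] [Algebra k E] (y z : σ → E) :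
    aeval (Sum.elim y z) ∘ cramerRelation h s =
      cramerDefect (Matrix.of fun j => gradient y (h j)) s z := by
  have jacobian_map : ((jacobian h).map (rename Sum.inl : MvPolynomial σ k →ₐ[k] _)).map
      (aeval (Sum.elim y z)) = Matrix.of fun j => gradient y (h j) := by
    ext j i
    simp [jacobian, gradient, aeval_rename]
  have X_map : aeval (Sum.elim y z) ∘ (X ∘ Sum.inr : σ → MvPolynomial (σ ⊕ σ) k) = z := by
    ext i
    simp
  have comp_eq := comp_cramerDefect (aeval (Sum.elim y z) : MvPolynomial _ k →ₐ[k] E).toRingHom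
    ((jacobian h).map (rename Sum.inl : MvPolynomial σ k →ₐ[k] _)) s (X ∘ Sum.inr)
  exact comp_eq.trans (congrArg₂ (cramerDefect · s ·) jacobian_map X_map)

/-- The `h j` are equations of `V` which generate its normal space at the generic point, and the
columns `s` select a maximal minor of their Jacobian matrix that is not identically zero on `V`.
Thus `V` is smooth where this minor is nonzero. -/
structure IsJacobianChart (V : Set (σ → k)) (h : Fin r → MvPolynomial σ k) (s : Fin r → σ) :
    Prop where
  mem : ∀ j, h j ∈ vanishingIdeal k V
  span_eq : Submodule.span (FunctionField (vanishingIdeal k V))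
      (Set.range fun j => gradient (genericPoint (vanishingIdeal k V)) (h j)) =
    normalSpan (vanishingIdeal k V) (genericPoint (vanishingIdeal k V))
  notMem : jacobianMinor h s ∉ vanishingIdeal k V

variable {V : Set (σ → k)}

theorem exists_isJacobianChart [CharZero k] [Finite σ] [(vanishingIdeal k V).IsPrime]
    {ι : Type*} {f : ι → MvPolynomial σ k} (hf : ∀ j, f j ∈ vanishingIdeal k V)
    (hspan : Submodule.span (FunctionField (vanishingIdeal k V))
        (Set.range fun j => gradient (genericPoint (vanishingIdeal k V)) (f j)) =
      normalSpan (vanishingIdeal k V) (genericPoint (vanishingIdeal k V))) :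
    ∃ (r : ℕ) (a : Fin r → ι) (s : Fin r → σ), IsJacobianChart V (f ∘ a) s := by
  have := Fintype.ofFinite σ
  obtain ⟨r, a, -, linearIndependent, span_eq⟩ := exists_basis_gradients _ hspan
  obtain ⟨s, notMem⟩ := exists_jacobianMinor_notMem (h := f ∘ a) _ linearIndependent
  exact ⟨r, a, s, fun j => hf _, span_eq, notMem⟩

namespace IsJacobianChart

theorem ringKrullDim_add [CharZero k] [Fintype σ] [(vanishingIdeal k V).IsPrime]
    (hc : IsJacobianChart V h s) :
    ringKrullDim (MvPolynomial σ k ⧸ vanishingIdeal k V) + r = Fintype.card σ := by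
  have minor_ne_zero : aeval (genericPoint (vanishingIdeal k V)) (jacobianMinor h s) ≠ 0 :=
    fun h0 => hc.notMem ((aeval_genericPoint_eq_zero _).1 h0)
  have finrank_eq := finrank_span_eq_card (linearIndependent_of_aeval_jacobianMinor minor_ne_zero)
  rw [hc.span_eq, Fintype.card_fin] at finrank_eq
  rw [add_comm, ← finrank_eq, finrank_normalSpan_add_ringKrullDim]

variable [Infinite k] {E : Type*} [Field E] [Algebra k E] {y z : σ → E}

theorem mem_span_gradient (hc : IsJacobianChart V h s)
    (hyz : ∀ F ∈ conormalIdeal V, aeval (Sum.elim y z) F = 0)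
    (hy : aeval y (jacobianMinor h s) ≠ 0) :
    z ∈ Submodule.span E (Set.range fun j => gradient y (h j)) := by
  have relation_mem (i : σ) : cramerRelation h s i ∈ conormalIdeal V :=
    mem_conormalIdeal_iff.2 fun w hw => congr_fun ((aeval_comp_cramerRelation _ w).trans
      (cramerDefect_eq_zero s (hc.span_eq.symm ▸ hw :))) i
  rw [aeval_jacobianMinor] at hy
  refine mem_span_of_cramerDefect_eq_zero (M := Matrix.of fun j => gradient y (h j)) hy ?_
  rw [← aeval_comp_cramerRelation]
  exact _root_.funext fun i => hyz _ (relation_mem i)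

theorem normalSpan_eq (hc : IsJacobianChart V h s)
    (hyV : ∀ f ∈ vanishingIdeal k V, aeval y f = 0) (hy : aeval y (jacobianMinor h s) ≠ 0) :
    normalSpan (vanishingIdeal k V) y =
      Submodule.span E (Set.range fun j => gradient y (h j)) := by
  refine le_antisymm (fun z hz => hc.mem_span_gradient
    (fun F hF => aeval_eq_zero_of_mem_conormalIdeal hF hyV hz) hy) (Submodule.span_le.2 ?_)
  rintro _ ⟨j, rfl⟩
  exact gradient_mem_normalSpan y (hc.mem j)

end IsJacobianChart

end Minors

section Scaling

variable {k σ : Type*} [Field k] {w : σ → ℕ} {F : MvPolynomial σ k} {d : ℕ}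

theorem coeff_aeval_X_pow_mul_C (F : MvPolynomial σ k) (z : σ → k) (d : ℕ) :
    (aeval (fun i => Polynomial.X ^ w i * Polynomial.C (z i)) F : Polynomial k).coeff d =
      aeval z (weightedHomogeneousComponent w d F) := by
  classical
  induction F using MvPolynomial.induction_on' with
  | add F G hF hG => rw [map_add, map_add, map_add, Polynomial.coeff_add, hF, hG]
  | monomial m a =>
    have monomial_eq :
        (aeval (fun i => Polynomial.X ^ w i * Polynomial.C (z i)) (monomial m a) : Polynomial k) =
          Polynomial.C (aeval z (monomial m a)) * Polynomial.X ^ Finsupp.weight w m := by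
      simp only [aeval_monomial, Finsupp.weight_apply, Finsupp.prod, Finsupp.sum, mul_pow,
        Finset.prod_mul_distrib, ← pow_mul, Finset.prod_pow_eq_pow_sum, smul_eq_mul, map_mul,
        map_prod, map_pow, Polynomial.algebraMap_eq, Algebra.algebraMap_self, RingHom.id_apply,
        mul_comm (w _)]
      ring
    rw [monomial_eq, Polynomial.coeff_C_mul, Polynomial.coeff_X_pow]
    by_cases hd : d = Finsupp.weight w m
    · rw [weightedHomogeneousComponent_of_mem (isWeightedHomogeneous_monomial w m a hd.symm)]
      simp [hd]
    · rw [(isWeightedHomogeneous_monomial w m a rfl).weightedHomogeneousComponent_ne d hd]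
      simp [hd]

theorem eval_aeval_X_pow_mul_C (F : MvPolynomial σ k) (z : σ → k) (t : k) :
    (aeval (fun i => Polynomial.X ^ w i * Polynomial.C (z i)) F : Polynomial k).eval t =
      aeval (fun i => t ^ w i * z i) F := by
  rw [← Polynomial.coe_aeval_eq_eval]
  refine (comp_aeval_apply _ (Polynomial.aeval t) F).trans ?_
  simp only [map_mul, map_pow, Polynomial.aeval_X, Polynomial.aeval_C, Algebra.algebraMap_self,
    RingHom.id_apply]

theorem aeval_pow_mul_of_isWeightedHomogeneous (hF : F.IsWeightedHomogeneous w d) (t : k)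
    (z : σ → k) : aeval (fun i => t ^ w i * z i) F = t ^ d * aeval z F := by
  have monomial_eq :
      (aeval (fun i => Polynomial.X ^ w i * Polynomial.C (z i)) F : Polynomial k) =
        Polynomial.C (aeval z F) * Polynomial.X ^ d := by
    ext e
    rw [coeff_aeval_X_pow_mul_C, Polynomial.coeff_C_mul, Polynomial.coeff_X_pow]
    by_cases he : e = d
    · rw [he, hF.weightedHomogeneousComponent_same, if_pos rfl, mul_one]
    · rw [hF.weightedHomogeneousComponent_ne e he, map_zero, if_neg he, mul_zero]
  rw [← eval_aeval_X_pow_mul_C, monomial_eq, Polynomial.eval_mul, Polynomial.eval_C,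
    Polynomial.eval_pow, Polynomial.eval_X, mul_comm]

theorem aeval_smul_of_isHomogeneous (hF : F.IsHomogeneous d) (t : k) (z : σ → k) :
    aeval (t • z) F = t ^ d * aeval z F := by
  rw [← aeval_pow_mul_of_isWeightedHomogeneous hF]
  simp only [Pi.one_apply, pow_one]
  rfl

theorem aeval_eq_zero_of_weightedHomogeneousComponent (w : σ → ℕ) {z : σ → k}
    (hF : ∀ d, aeval z (weightedHomogeneousComponent w d F) = 0) : aeval z F = 0 := by
  have eq_zero :
      (aeval (fun i => Polynomial.X ^ w i * Polynomial.C (z i)) F : Polynomial k) = 0 := by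
    ext d
    rw [coeff_aeval_X_pow_mul_C, hF, Polynomial.coeff_zero]
  have at_one := eval_aeval_X_pow_mul_C (w := w) F z 1
  simp only [eq_zero, Polynomial.eval_zero, one_pow, one_mul] at at_one
  exact at_one.symm

theorem weightedHomogeneousComponent_mem_vanishingIdeal [Infinite k] {Z : Set (σ → k)}
    (hZ : ∀ t : k, t ≠ 0 → ∀ z ∈ Z, (fun i => t ^ w i * z i) ∈ Z)
    (hF : F ∈ vanishingIdeal k Z) (d : ℕ) :
    weightedHomogeneousComponent w d F ∈ vanishingIdeal k Z := by
  refine mem_vanishingIdeal_iff.2 fun z hz => ?_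
  have eq_zero :
      (aeval (fun i => Polynomial.X ^ w i * Polynomial.C (z i)) F : Polynomial k) = 0 := by
    refine Polynomial.eq_zero_of_infinite_isRoot _
      ((Set.finite_singleton (0 : k)).infinite_compl.mono fun t ht => ?_)
    exact (eval_aeval_X_pow_mul_C F z t).trans (mem_vanishingIdeal_iff.1 hF _ (hZ t ht z hz))
  rw [← coeff_aeval_X_pow_mul_C, eq_zero, Polynomial.coeff_zero]

theorem isWeightedHomogeneous_weightedHomogeneousComponent {w' : σ → ℕ} (e : ℕ)
    (hF : F.IsWeightedHomogeneous w d) :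
    (weightedHomogeneousComponent w' e F).IsWeightedHomogeneous w d := by
  classical
  intro m hm
  rw [coeff_weightedHomogeneousComponent, ne_eq, ite_eq_right_iff, not_forall] at hm
  exact hF hm.choose_spec

theorem isHomogeneous_jacobianMinor {r : ℕ} {h : Fin r → MvPolynomial σ k}
    (hh : ∀ j, ∃ d, (h j).IsHomogeneous d) (s : Fin r → σ) :
    ∃ d, (jacobianMinor h s).IsHomogeneous d := by
  choose d hd using hh
  refine ⟨∑ j, (d j - 1), ?_⟩
  rw [jacobianMinor, Matrix.det_apply]
  refine IsHomogeneous.sum _ _ _ fun π _ => (homogeneousSubmodule σ k _).smul_of_tower_mem _ ?_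
  rw [← Equiv.sum_comp π]
  exact IsHomogeneous.prod _ _ _ fun i _ => (hd (π i)).pderiv

end Scaling

section ConeScaling

variable {k σ : Type*} [Field k] {V : Set (σ → k)}

theorem aeval_eq_zero_of_mapsTo {τ : Type*} {Z : Set (σ → k)} {Z' : Set (τ → k)}
    (φ : τ → MvPolynomial σ k) (hφ : ∀ z ∈ Z, (fun i => aeval z (φ i)) ∈ Z') {z : σ → k}
    (hz : ∀ F ∈ vanishingIdeal k Z, aeval z F = 0) {F : MvPolynomial τ k}
    (hF : F ∈ vanishingIdeal k Z') : aeval (fun i => aeval z (φ i)) F = 0 := by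
  rw [← aeval_aeval]
  refine hz _ (mem_vanishingIdeal_iff.2 fun v hv => ?_)
  rw [aeval_aeval]
  exact mem_vanishingIdeal_iff.1 hF _ (hφ v hv)

theorem gradient_mem_span_isHomogeneous [Infinite k] (hV : ∀ t : k, ∀ v ∈ V, t • v ∈ V)
    {E : Type*} [CommRing E] [Algebra k E] (y : σ → E) {f : MvPolynomial σ k}
    (hf : f ∈ vanishingIdeal k V) :
    gradient y f ∈ Submodule.span E (Set.range fun h : {h : MvPolynomial σ k //
      h ∈ vanishingIdeal k V ∧ ∃ d, h.IsHomogeneous d} => gradient y h.1) := by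
  have gradient_eq :
      gradient y f =
        ∑ d ∈ Finset.range (f.totalDegree + 1), gradient y (homogeneousComponent d f) := by
    ext i
    conv_lhs => rw [← sum_homogeneousComponent f]
    simp [gradient]
  rw [gradient_eq]
  refine Submodule.sum_mem _ fun d _ => Submodule.subset_span
    ⟨⟨_, ?_, d, homogeneousComponent_isHomogeneous d f⟩, rfl⟩
  refine weightedHomogeneousComponent_mem_vanishingIdeal (fun t _ z hz => ?_) hf d
  simp only [Pi.one_apply, pow_one]
  exact hV t z hz

theorem mem_normalSpan_smul [Infinite k] (hV : ∀ t : k, ∀ v ∈ V, t • v ∈ V) {t : k} (ht : t ≠ 0)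
    {v z : σ → k} (hz : z ∈ normalSpan (vanishingIdeal k V) v) :
    z ∈ normalSpan (vanishingIdeal k V) (t • v) := by
  refine normalSpan_le.2 (fun f hf => ?_) hz
  refine Submodule.span_le.2 ?_ (gradient_mem_span_isHomogeneous hV v hf)
  rintro _ ⟨⟨h, hh, d, hd⟩, rfl⟩
  have gradient_smul : gradient (t • v) h = t ^ (d - 1) • gradient v h := by
    ext i
    exact aeval_smul_of_isHomogeneous hd.pderiv t v
  refine (Submodule.smul_mem_iff _ (pow_ne_zero (d - 1) ht)).1 ?_
  rw [← gradient_smul]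
  exact gradient_mem_normalSpan _ hh

theorem smul_smul_mem_conormalCone [Infinite k] (hV : ∀ t : k, ∀ v ∈ V, t • v ∈ V) {t s : k}
    (ht : t ≠ 0) {p q : σ → k} (h : Sum.elim p q ∈ conormalCone V) :
    Sum.elim (t • p) (s • q) ∈ conormalCone V :=
  mem_conormalCone.2 ⟨hV t p h.1, Submodule.smul_mem _ _ (mem_normalSpan_smul hV ht h.2)⟩

theorem aeval_smul_smul_eq_zero_of_mem_conormalIdeal [Infinite k]
    (hV : ∀ t : k, ∀ v ∈ V, t • v ∈ V) {t s : k} (ht : t ≠ 0) {p q : σ → k}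
    (h : ∀ F ∈ conormalIdeal V, aeval (Sum.elim p q) F = 0) {F : MvPolynomial (σ ⊕ σ) k}
    (hF : F ∈ conormalIdeal V) : aeval (Sum.elim (t • p) (s • q)) F = 0 := by
  let scaling : σ ⊕ σ → MvPolynomial (σ ⊕ σ) k :=
    Sum.elim (fun i => C t * X (Sum.inl i)) (fun i => C s * X (Sum.inr i))
  have aeval_scaling (z : σ ⊕ σ → k) : (fun i => aeval z (scaling i)) =
      Sum.elim (t • (z ∘ Sum.inl)) (s • (z ∘ Sum.inr)) := by
    ext (i | i) <;> simp [scaling]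
  have scaled := aeval_eq_zero_of_mapsTo scaling (fun z hz => ?_) h hF
  · rwa [aeval_scaling] at scaled
  · rw [aeval_scaling]
    exact smul_smul_mem_conormalCone hV ht hz

end ConeScaling

section Projective

variable {σ : Type} {X : Set (ProjSpace σ)}

theorem rep_mem_affineCone {x : ProjSpace σ} : x.rep ∈ affineCone X ↔ x ∈ X :=
  ⟨fun h => x.mk_rep ▸ h x.rep_nonzero, fun h _ => x.mk_rep.symm ▸ h⟩

theorem smul_mem_affineCone (t : ℂ) (v : σ → ℂ) (hv : v ∈ affineCone X) :
    t • v ∈ affineCone X := by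
  intro hne
  have mk_eq : Projectivization.mk ℂ (t • v) hne =
      Projectivization.mk ℂ v (right_ne_zero_of_smul hne) :=
    (Projectivization.mk_eq_mk_iff' ℂ _ _ _ _).2 ⟨t, rfl⟩
  exact mk_eq ▸ hv _

theorem isIrreducibleCone_affineCone (hX : (homIdeal X).IsPrime) :
    IsIrreducibleCone (affineCone X) :=
  ⟨smul_mem_affineCone, hX⟩

theorem aeval_rep_eq_zero {f : MvPolynomial σ ℂ} (hf : f ∈ homIdeal X) {x : ProjSpace σ}
    (hx : x ∈ X) : aeval x.rep f = 0 :=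
  mem_vanishingIdeal_iff.1 hf _ (rep_mem_affineCone.2 hx)

theorem exists_rep_apply_ne_zero (x : ProjSpace σ) : ∃ i, x.rep i ≠ 0 :=
  Function.ne_iff.1 x.rep_nonzero

theorem exists_X_notMem_homIdeal (hne : X.Nonempty) : ∃ i : σ, MvPolynomial.X i ∉ homIdeal X := by
  obtain ⟨x, hx⟩ := hne
  obtain ⟨i, hi⟩ := exists_rep_apply_ne_zero x
  exact ⟨i, fun h => hi (by simpa using aeval_rep_eq_zero h hx)⟩

theorem exists_mk_rep_eq_smul {v : σ → ℂ} (hv : v ≠ 0) :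
    ∃ t : ℂ, t ≠ 0 ∧ (Projectivization.mk ℂ v hv).rep = t • v := by
  obtain ⟨a, ha⟩ := Projectivization.exists_smul_eq_mk_rep ℂ v hv
  exact ⟨a, a.ne_zero, ha.symm⟩

variable [Fintype σ]

theorem tangentSpace_eq_perp (X : Set (ProjSpace σ)) (x : ProjSpace σ) :
    tangentSpace X x = perp (normalSpan (homIdeal X) x.rep) :=
  Submodule.ext fun _ => mem_perp_normalSpan.symm

theorem orthogonal_tangentSpace_iff {x : ProjSpace σ} {q : σ → ℂ} :
    (∀ v ∈ tangentSpace X x, ∑ i, q i * v i = 0) ↔ q ∈ normalSpan (homIdeal X) x.rep := by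
  rw [← perp_perp (normalSpan _ _), ← tangentSpace_eq_perp, mem_perp]
  simp only [dotProduct, mul_comm]

theorem IsJacobianChart.mem_regularPoints [(homIdeal X).IsPrime] {r : ℕ}
    {h : Fin r → MvPolynomial σ ℂ} {s : Fin r → σ} (hc : IsJacobianChart (affineCone X) h s)
    {x : ProjSpace σ} (hx : x ∈ X) (hs : aeval x.rep (jacobianMinor h s) ≠ 0) :
    x ∈ regularPoints X := by
  have : (vanishingIdeal ℂ (affineCone X)).IsPrime := ‹(homIdeal X).IsPrime›
  have finrank_normalSpan : Module.finrank ℂ (normalSpan (homIdeal X) x.rep) = r := by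
    rw [homIdeal, hc.normalSpan_eq (fun f hf => aeval_rep_eq_zero hf hx) hs,
      finrank_span_eq_card (linearIndependent_of_aeval_jacobianMinor hs), Fintype.card_fin]
  have finrank_add := finrank_add_finrank_perp (normalSpan (homIdeal X) x.rep)
  rw [← tangentSpace_eq_perp, finrank_normalSpan] at finrank_add
  refine ⟨hx, (ENat.WithBot.add_natCast_cancel (c := r)).1 ?_⟩
  rw [coneDim, homIdeal, hc.ringKrullDim_add, ← finrank_add, Nat.cast_add, add_comm]

end Projective

section ConormalVariety

theorem mem_conormalIdeal_of_forall_ne_zero {k σ : Type*} [Field k] [CharZero k] [Finite σ]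
    {V : Set (σ → k)} [(vanishingIdeal k V).IsPrime] {f : MvPolynomial σ k}
    (hf : f ∉ vanishingIdeal k V) {F : MvPolynomial (σ ⊕ σ) k}
    (hF : ∀ p q, Sum.elim p q ∈ conormalCone V → aeval p f ≠ 0 → aeval (Sum.elim p q) F = 0) :
    F ∈ conormalIdeal V := by
  have mul_mem : rename Sum.inl f * F ∈ conormalIdeal V := by
    refine mem_vanishingIdeal_iff.2 fun z hz => ?_
    rw [map_mul, aeval_rename, mul_eq_zero, or_iff_not_imp_left]
    intro hfz
    rw [← Sum.elim_comp_inl_inr z] at hz ⊢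
    exact hF _ _ hz hfz
  exact ((isPrime_conormalIdeal V).mem_or_mem mul_mem).resolve_left
    fun h => hf (rename_inl_mem_conormalIdeal.1 h)

variable {σ : Type} {X : Set (ProjSpace σ)}

theorem pow_mul_sumElim_left (t : ℂ) (p q : σ → ℂ) :
    (fun i => t ^ (Sum.elim (fun _ => 1) (fun _ => 0) : σ ⊕ σ → ℕ) i * Sum.elim p q i) =
      Sum.elim (t • p) q := by
  ext (i | i) <;> simp

theorem pow_mul_sumElim_right (t : ℂ) (p q : σ → ℂ) :
    (fun i => t ^ (Sum.elim (fun _ => 0) (fun _ => 1) : σ ⊕ σ → ℕ) i * Sum.elim p q i) =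
      Sum.elim p (t • q) := by
  ext (i | i) <;> simp

theorem aeval_smul_smul_of_isBihomogeneous {F : MvPolynomial (σ ⊕ σ) ℂ} {d e : ℕ}
    (hF : IsBihomogeneous F d e) (t s : ℂ) (p q : σ → ℂ) :
    aeval (Sum.elim (t • p) (s • q)) F = s ^ e * (t ^ d * aeval (Sum.elim p q) F) := by
  rw [← aeval_pow_mul_of_isWeightedHomogeneous hF.1, pow_mul_sumElim_left,
    ← aeval_pow_mul_of_isWeightedHomogeneous hF.2, pow_mul_sumElim_right]

theorem isBihomogeneous_components (F : MvPolynomial (σ ⊕ σ) ℂ) (d e : ℕ) :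
    IsBihomogeneous (weightedHomogeneousComponent (Sum.elim (fun _ => 0) (fun _ => 1)) e
      (weightedHomogeneousComponent (Sum.elim (fun _ => 1) (fun _ => 0)) d F)) d e :=
  ⟨isWeightedHomogeneous_weightedHomogeneousComponent e
    (weightedHomogeneousComponent_isWeightedHomogeneous d F),
    weightedHomogeneousComponent_isWeightedHomogeneous e _⟩

theorem components_mem_conormalIdeal {F : MvPolynomial (σ ⊕ σ) ℂ}
    (hF : F ∈ conormalIdeal (affineCone X)) (d e : ℕ) :
    weightedHomogeneousComponent (Sum.elim (fun _ => 0) (fun _ => 1)) e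
      (weightedHomogeneousComponent (Sum.elim (fun _ => 1) (fun _ => 0)) d F) ∈
        conormalIdeal (affineCone X) := by
  refine weightedHomogeneousComponent_mem_vanishingIdeal (fun t _ z hz => ?_)
    (weightedHomogeneousComponent_mem_vanishingIdeal (fun t ht z hz => ?_) hF d) e <;>
    rw [← Sum.elim_comp_inl_inr z] at hz ⊢
  · rw [pow_mul_sumElim_right, ← one_smul ℂ (z ∘ Sum.inl)]
    exact smul_smul_mem_conormalCone smul_mem_affineCone one_ne_zero hz
  · rw [pow_mul_sumElim_left, ← one_smul ℂ (z ∘ Sum.inr)]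
    exact smul_smul_mem_conormalCone smul_mem_affineCone ht hz

theorem exists_isHomogeneous_isJacobianChart [Finite σ] (hX : (homIdeal X).IsPrime) :
    ∃ (r : ℕ) (h : Fin r → MvPolynomial σ ℂ) (s : Fin r → σ),
      (∀ j, ∃ d, (h j).IsHomogeneous d) ∧ IsJacobianChart (affineCone X) h s := by
  have : (vanishingIdeal ℂ (affineCone X)).IsPrime := hX
  obtain ⟨r, a, s, chart⟩ := exists_isJacobianChart (V := affineCone X)
    (f := fun h : {h : MvPolynomial σ ℂ // h ∈ homIdeal X ∧ ∃ d, h.IsHomogeneous d} => h.1)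
    (fun h => h.2.1)
    (le_antisymm
      (Submodule.span_le.2 (Set.range_subset_iff.2 fun h => gradient_mem_normalSpan _ h.2.1))
      (normalSpan_le.2 fun f hf => gradient_mem_span_isHomogeneous smul_mem_affineCone _ hf))
  exact ⟨r, _, s, fun j => (a j).2.2, chart⟩

variable [Fintype σ]

theorem aeval_eq_zero_of_mem_conormalVariety {x y : ProjSpace σ}
    (hxy : (x, y) ∈ conormalVariety X) {F : MvPolynomial (σ ⊕ σ) ℂ}
    (hF : F ∈ conormalIdeal (affineCone X)) : aeval (Sum.elim x.rep y.rep) F = 0 := by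
  refine aeval_eq_zero_of_weightedHomogeneousComponent
    (Sum.elim (fun _ => 1) (fun _ => 0)) fun d => ?_
  refine aeval_eq_zero_of_weightedHomogeneousComponent
    (Sum.elim (fun _ => 0) (fun _ => 1)) fun e => ?_
  refine hxy _ d e (isBihomogeneous_components F d e) fun z hz => ?_
  exact mem_vanishingIdeal_iff.1 (components_mem_conormalIdeal hF d e) _ (mem_conormalCone.2
    ⟨rep_mem_affineCone.2 hz.1.1, orthogonal_tangentSpace_iff.1 hz.2⟩)

theorem exists_regularPoints_of_ne_zero (hX : (homIdeal X).IsPrime) :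
    ∃ f ∉ homIdeal X, ∀ (p : σ → ℂ) (hp : p ≠ 0), p ∈ affineCone X → aeval p f ≠ 0 →
      Projectivization.mk ℂ p hp ∈ regularPoints X := by
  obtain ⟨r, h, s, h_homogeneous, chart⟩ := exists_isHomogeneous_isJacobianChart hX
  obtain ⟨m, minor_homogeneous⟩ := isHomogeneous_jacobianMinor h_homogeneous s
  refine ⟨_, chart.notMem, fun p hp hpX minor_ne_zero => chart.mem_regularPoints (hpX hp) ?_⟩
  obtain ⟨t, ht, rep_eq⟩ := exists_mk_rep_eq_smul hp
  rw [rep_eq]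
  exact (aeval_smul_of_isHomogeneous minor_homogeneous t p).trans_ne
    (mul_ne_zero (pow_ne_zero m ht) minor_ne_zero)

theorem mem_conormalVariety_of_forall (hX : (homIdeal X).IsPrime) (hne : X.Nonempty)
    {x y : ProjSpace σ}
    (h : ∀ F ∈ conormalIdeal (affineCone X), aeval (Sum.elim x.rep y.rep) F = 0) :
    (x, y) ∈ conormalVariety X := by
  intro F d e hF hZ
  have : (vanishingIdeal ℂ (affineCone X)).IsPrime := hX
  obtain ⟨k, y_ne_zero⟩ := exists_rep_apply_ne_zero y
  obtain ⟨l, X_notMem⟩ := exists_X_notMem_homIdeal hne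
  obtain ⟨f, f_notMem, hf⟩ := exists_regularPoints_of_ne_zero hX
  suffices mul_mem : F * MvPolynomial.X (Sum.inr k) ∈ conormalIdeal (affineCone X) by
    have mul_eq_zero := h _ mul_mem
    rw [map_mul, aeval_X] at mul_eq_zero
    exact (_root_.mul_eq_zero.1 mul_eq_zero).resolve_right y_ne_zero
  refine mem_conormalIdeal_of_forall_ne_zero (f := f * MvPolynomial.X l)
    (fun hmul => (hX.mem_or_mem hmul).elim f_notMem X_notMem) fun p q hpq hne => ?_
  rw [map_mul, mul_ne_zero_iff, aeval_X] at hne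
  rw [map_mul, aeval_X, Sum.elim_inr, mul_eq_zero, or_iff_not_imp_right]
  intro hqk
  have hp : p ≠ 0 := ne_of_apply_ne (· l) hne.2
  have hq : q ≠ 0 := ne_of_apply_ne (· k) hqk
  obtain ⟨t, ht, rep_p⟩ := exists_mk_rep_eq_smul hp
  obtain ⟨s, hs, rep_q⟩ := exists_mk_rep_eq_smul hq
  have vanishes := hZ (Projectivization.mk ℂ p hp, Projectivization.mk ℂ q hq)
    ⟨hf p hp hpq.1 hne.1, orthogonal_tangentSpace_iff.2 <| by
      dsimp only
      rw [rep_p, rep_q]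
      exact (smul_smul_mem_conormalCone smul_mem_affineCone ht hpq).2⟩
  rw [rep_p, rep_q] at vanishes
  refine (mul_eq_zero.1 ((mul_eq_zero.1 ?_).resolve_left (pow_ne_zero e hs))).resolve_left
    (pow_ne_zero d ht)
  exact (aeval_smul_smul_of_isBihomogeneous hF t s p q).symm.trans vanishes

theorem mk_mem_conormalVariety_iff (hX : (homIdeal X).IsPrime) (hne : X.Nonempty) {p q : σ → ℂ}
    (hp : p ≠ 0) (hq : q ≠ 0) :
    (Projectivization.mk ℂ p hp, Projectivization.mk ℂ q hq) ∈ conormalVariety X ↔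
      ∀ F ∈ conormalIdeal (affineCone X), aeval (Sum.elim p q) F = 0 := by
  obtain ⟨t, ht, rep_p⟩ := exists_mk_rep_eq_smul hp
  obtain ⟨s, hs, rep_q⟩ := exists_mk_rep_eq_smul hq
  constructor
  · intro h F hF
    have vanishes : ∀ G ∈ conormalIdeal (affineCone X), aeval (Sum.elim (t • p) (s • q)) G = 0 :=
      fun G hG => rep_p ▸ rep_q ▸ aeval_eq_zero_of_mem_conormalVariety h hG
    simpa only [inv_smul_smul₀ ht, inv_smul_smul₀ hs] using
      aeval_smul_smul_eq_zero_of_mem_conormalIdeal smul_mem_affineCone (s := s⁻¹)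
        (inv_ne_zero ht) vanishes hF
  · intro h
    refine mem_conormalVariety_of_forall hX hne fun F hF => ?_
    rw [rep_p, rep_q]
    exact aeval_smul_smul_eq_zero_of_mem_conormalIdeal smul_mem_affineCone ht h hF

theorem homIdeal_dualVariety (hX : (homIdeal X).IsPrime) (hne : X.Nonempty) :
    homIdeal (dualVariety X) =
      (conormalIdeal (affineCone X)).comap (rename Sum.inr : MvPolynomial σ ℂ →ₐ[ℂ] _) := by
  have : (vanishingIdeal ℂ (affineCone X)).IsPrime := hX
  refine le_antisymm (fun f hf => ?_) (fun f hf => mem_vanishingIdeal_iff.2 fun q hq => ?_)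
  · obtain ⟨l, X_notMem⟩ := exists_X_notMem_homIdeal hne
    refine mem_conormalIdeal_of_forall_ne_zero X_notMem fun p q hpq hpl => ?_
    change aeval _ (rename Sum.inr f) = 0
    rw [aeval_X] at hpl
    rw [aeval_rename, Sum.elim_comp_inr]
    refine mem_vanishingIdeal_iff.1 hf q fun hq => ⟨(_, _),
      (mk_mem_conormalVariety_iff hX hne (ne_of_apply_ne (· l) hpl) hq).2 fun F hF => ?_, rfl⟩
    exact mem_vanishingIdeal_iff.1 hF _ hpq
  · suffices ∃ p, ∀ F ∈ conormalIdeal (affineCone X), aeval (Sum.elim p q) F = 0 by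
      obtain ⟨p, hp⟩ := this
      have vanishes := hp _ (Ideal.mem_comap.1 hf)
      rwa [aeval_rename, Sum.elim_comp_inr] at vanishes
    by_cases hq0 : q = 0
    · obtain ⟨x, hx⟩ := hne
      refine ⟨x.rep, fun F hF => mem_vanishingIdeal_iff.1 hF _ (mem_conormalCone.2
        ⟨rep_mem_affineCone.2 hx, hq0 ▸ Submodule.zero_mem _⟩)⟩
    · obtain ⟨⟨x, y⟩, hxy, rfl : y = _⟩ := hq hq0
      rw [← x.mk_rep] at hxy
      exact ⟨x.rep, (mk_mem_conormalVariety_iff hX hne x.rep_nonzero hq0).1 hxy⟩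

theorem isPrime_homIdeal_dualVariety (hX : (homIdeal X).IsPrime) (hne : X.Nonempty) :
    (homIdeal (dualVariety X)).IsPrime := by
  have : (vanishingIdeal ℂ (affineCone X)).IsPrime := hX
  have := isPrime_conormalIdeal (affineCone X)
  exact homIdeal_dualVariety hX hne ▸ Ideal.comap_isPrime _ _

theorem forall_conormalIdeal_dualVariety_iff (hX : (homIdeal X).IsPrime) (hne : X.Nonempty)
    {p q : σ → ℂ} :
    (∀ F ∈ conormalIdeal (affineCone (dualVariety X)), aeval (Sum.elim q p) F = 0) ↔
      ∀ F ∈ conormalIdeal (affineCone X), aeval (Sum.elim p q) F = 0 := by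
  have mem_iff := rename_swap_mem_conormalIdeal_iff (isIrreducibleCone_affineCone hX)
    (isPrime_homIdeal_dualVariety hX hne) (homIdeal_dualVariety hX hne)
  have aeval_swap (p q : σ → ℂ) (F : MvPolynomial (σ ⊕ σ) ℂ) :
      aeval (Sum.elim p q) (rename Sum.swap F) = aeval (Sum.elim q p) F := by
    rw [aeval_rename, Sum.elim_swap]
  constructor
  · intro h F hF
    rw [← aeval_swap]
    exact h _ ((mem_iff F).2 hF)
  · intro h F hF
    rw [← aeval_swap]
    refine h _ ((mem_iff _).1 ?_)
    rwa [rename_rename, Sum.swap_swap_eq, rename_id_apply]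

theorem aeval_eq_zero_of_mem_homIdeal_dualVariety (hX : (homIdeal X).IsPrime) (hne : X.Nonempty)
    {p q : σ → ℂ} (hpq : ∀ F ∈ conormalIdeal (affineCone X), aeval (Sum.elim p q) F = 0)
    {f : MvPolynomial σ ℂ} (hf : f ∈ homIdeal (dualVariety X)) : aeval q f = 0 := by
  rw [homIdeal_dualVariety hX hne, Ideal.mem_comap] at hf
  have vanishes := hpq _ hf
  rwa [aeval_rename, Sum.elim_comp_inr] at vanishes

end ConormalVariety

section SumEmbedding

variable {n : ℕ}

section Coordinates

variable {E : Type*} [CommRing E]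

/-- The point `(p_0, …, p_n, p_0 + ⋯ + p_n)` of the hyperplane that contains `X'`. -/
def sumExt (p : Fin (n + 1) → E) : Fin (n + 2) → E :=
  Fin.snoc (α := fun _ => E) p (∑ i, p i)

@[simp] theorem sumExt_castSucc (p : Fin (n + 1) → E) (i : Fin (n + 1)) :
    sumExt p i.castSucc = p i := by simp [sumExt]

@[simp] theorem sumExt_last (p : Fin (n + 1) → E) :
    sumExt p (Fin.last (n + 1)) = ∑ i, p i := by simp [sumExt]

theorem sumExt_comp_castSucc (p : Fin (n + 1) → E) : sumExt p ∘ Fin.castSucc = p :=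
  _root_.funext (sumExt_castSucc p)

theorem sumExt_smul (t : E) (p : Fin (n + 1) → E) : sumExt (t • p) = t • sumExt p := by
  ext i
  cases i using Fin.lastCases <;> simp [Finset.mul_sum]

theorem eq_sumExt_iff {w : Fin (n + 2) → E} :
    w = sumExt (w ∘ Fin.castSucc) ↔ w (Fin.last (n + 1)) = ∑ i : Fin (n + 1), w i.castSucc := by
  refine ⟨fun h => (congr_fun h _).trans (sumExt_last _), fun h => ?_⟩
  ext i
  cases i using Fin.lastCases <;> simp [h]

/-- The vector `(b_0 + b_s, …, b_n + b_s)`. The map `shiftVec` is the transpose of `sumExt`. -/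
def shiftVec : (Fin (n + 2) → E) →ₗ[E] (Fin (n + 1) → E) where
  toFun b := fun i => b i.castSucc + b (Fin.last (n + 1))
  map_add' _ _ := _root_.funext fun _ => add_add_add_comm _ _ _ _
  map_smul' t _ := _root_.funext fun _ => (mul_add t _ _).symm

theorem shiftVec_apply (b : Fin (n + 2) → E) (i : Fin (n + 1)) :
    shiftVec b i = b i.castSucc + b (Fin.last (n + 1)) := rfl

theorem dotProduct_sumExt (b : Fin (n + 2) → E) (p : Fin (n + 1) → E) :
    b ⬝ᵥ sumExt p = shiftVec b ⬝ᵥ p := by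
  rw [dotProduct, Fin.sum_univ_castSucc]
  simp only [dotProduct, sumExt_castSucc, sumExt_last, shiftVec_apply, add_mul,
    Finset.sum_add_distrib, Finset.mul_sum]

variable [Algebra ℂ E]

/-- The restriction of polynomials to the hyperplane `p_s = p_0 + ⋯ + p_n`. -/
def sumSubst (n : ℕ) : MvPolynomial (Fin (n + 2)) ℂ →ₐ[ℂ] MvPolynomial (Fin (n + 1)) ℂ :=
  aeval (sumExt X)

theorem aeval_comp_sumExt_X (p : Fin (n + 1) → E) :
    aeval p ∘ sumExt (X : Fin (n + 1) → MvPolynomial (Fin (n + 1)) ℂ) = sumExt p := by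
  ext i
  cases i using Fin.lastCases <;> simp

theorem aeval_sumSubst (p : Fin (n + 1) → E) (h : MvPolynomial (Fin (n + 2)) ℂ) :
    aeval p (sumSubst n h) = aeval (sumExt p) h :=
  (aeval_aeval p _ h).trans (congrArg (aeval · h) (aeval_comp_sumExt_X p))

theorem sumSubst_rename_castSucc (f : MvPolynomial (Fin (n + 1)) ℂ) :
    sumSubst n (rename Fin.castSucc f) = f := by
  rw [sumSubst, aeval_rename, sumExt_comp_castSucc, aeval_X_left_apply]

theorem gradient_sumSubst (p : Fin (n + 1) → E) (h : MvPolynomial (Fin (n + 2)) ℂ) :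
    gradient p (sumSubst n h) = shiftVec (gradient (sumExt p) h) := by
  ext i
  have pderiv_sumExt : pderiv i ∘ sumExt X =
      sumExt (Pi.single i 1 : Fin (n + 1) → MvPolynomial (Fin (n + 1)) ℂ) := by
    ext1 j
    cases j using Fin.lastCases <;> simp [pderiv_X, Pi.single_apply, eq_comm]
  have pderiv_sumSubst : pderiv i (sumSubst n h) = shiftVec (gradient (sumExt X) h) i :=
    calc pderiv i (sumSubst n h) = gradient (sumExt X) h ⬝ᵥ (pderiv i ∘ sumExt X) :=
          derivation_aeval (pderiv i) (sumExt X) h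
      _ = shiftVec (gradient (sumExt X) h) i := by
          rw [pderiv_sumExt, dotProduct_sumExt, dotProduct_single_one]
  have aeval_gradient (j : Fin (n + 2)) :
      aeval p (gradient (sumExt (X : _ → MvPolynomial (Fin (n + 1)) ℂ)) h j) =
        gradient (sumExt p) h j := by
    rw [← aeval_comp_sumExt_X p, ← comp_gradient]
    rfl
  rw [gradient, pderiv_sumSubst, shiftVec_apply, map_add, aeval_gradient, aeval_gradient,
    shiftVec_apply]

/-- The equation of the hyperplane that contains `X'`. -/
def sumRelation (n : ℕ) : MvPolynomial (Fin (n + 2)) ℂ :=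
  X (Fin.last (n + 1)) - ∑ i : Fin (n + 1), X i.castSucc

theorem aeval_sumRelation_eq_zero {w : Fin (n + 2) → E} :
    aeval w (sumRelation n) = 0 ↔ w = sumExt (w ∘ Fin.castSucc) := by
  rw [eq_sumExt_iff, sumRelation, map_sub, map_sum, aeval_X, sub_eq_zero]
  simp only [aeval_X]

theorem gradient_sumRelation_dotProduct_eq_zero {y w : Fin (n + 2) → E} :
    gradient y (sumRelation n) ⬝ᵥ w = 0 ↔ w = sumExt (w ∘ Fin.castSucc) := by
  have gradient_castSucc (i : Fin (n + 1)) : gradient y (sumRelation n) i.castSucc = -1 := by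
    simp [gradient, sumRelation, pderiv_X, Pi.single_apply, eq_comm, Fin.castSucc_ne_last]
  have gradient_last : gradient y (sumRelation n) (Fin.last (n + 1)) = 1 := by
    simp [gradient, sumRelation, pderiv_X, Fin.castSucc_ne_last]
  rw [eq_sumExt_iff, dotProduct, Fin.sum_univ_castSucc, gradient_last]
  simp only [gradient_castSucc, neg_one_mul, one_mul, Finset.sum_neg_distrib]
  rw [neg_add_eq_zero, eq_comm]

end Coordinates

variable {X : Set (ProjSpace (Fin (n + 1)))}

theorem mk_mem_sumEmbedding_iff {w : Fin (n + 2) → ℂ} (hw : w ≠ 0) :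
    Projectivization.mk ℂ w hw ∈ sumEmbedding X ↔
      w ∘ Fin.castSucc ∈ affineCone X ∧ w = sumExt (w ∘ Fin.castSucc) := by
  obtain ⟨t, ht, rep_eq⟩ := exists_mk_rep_eq_smul hw
  have smul_mem_iff :
      t • (w ∘ Fin.castSucc) ∈ affineCone X ↔ w ∘ Fin.castSucc ∈ affineCone X :=
    ⟨fun h => inv_smul_smul₀ ht (w ∘ Fin.castSucc) ▸ smul_mem_affineCone t⁻¹ _ h,
      smul_mem_affineCone t _⟩
  have smul_eq_iff : t • w = sumExt ((t • w) ∘ Fin.castSucc) ↔ w = sumExt (w ∘ Fin.castSucc) := by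
    rw [← (smul_right_injective _ ht).eq_iff (a := w), ← sumExt_smul]
    rfl
  rw [← smul_mem_iff, ← smul_eq_iff, ← rep_eq, eq_sumExt_iff]
  exact and_congr (rep_eq ▸ Iff.rfl) Iff.rfl

theorem mem_affineCone_sumEmbedding {w : Fin (n + 2) → ℂ} :
    w ∈ affineCone (sumEmbedding X) ↔ ∃ p ∈ affineCone X, w = sumExt p := by
  constructor
  · intro h
    by_cases hw : w = 0
    · refine ⟨0, fun h0 => absurd rfl h0, ?_⟩
      rw [hw, ← zero_smul ℂ (0 : Fin (n + 1) → ℂ), sumExt_smul, zero_smul]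
    · exact ⟨_, (mk_mem_sumEmbedding_iff hw).1 (h hw)⟩
  · rintro ⟨p, hp, rfl⟩ hw
    exact (mk_mem_sumEmbedding_iff hw).2 (by rw [sumExt_comp_castSucc]; exact ⟨hp, rfl⟩)

theorem homIdeal_sumEmbedding : homIdeal (sumEmbedding X) = (homIdeal X).comap (sumSubst n) := by
  ext h
  simp only [homIdeal, Ideal.mem_comap, mem_vanishingIdeal_iff, aeval_sumSubst,
    mem_affineCone_sumEmbedding]
  exact ⟨fun H p hp => H _ ⟨p, hp, rfl⟩, fun H w ⟨p, hp, hw⟩ => hw ▸ H p hp⟩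

theorem isPrime_homIdeal_sumEmbedding (hX : (homIdeal X).IsPrime) :
    (homIdeal (sumEmbedding X)).IsPrime :=
  homIdeal_sumEmbedding ▸ hX.comap (sumSubst n)

theorem sumEmbedding_nonempty (hne : X.Nonempty) : (sumEmbedding X).Nonempty := by
  obtain ⟨x, hx⟩ := hne
  obtain ⟨i, hi⟩ := exists_rep_apply_ne_zero x
  exact ⟨_, mem_affineCone_sumEmbedding.2 ⟨x.rep, rep_mem_affineCone.2 hx, rfl⟩
    (ne_of_apply_ne (· i.castSucc) (by simpa using hi))⟩

theorem sumRelation_mem_homIdeal_sumEmbedding : sumRelation n ∈ homIdeal (sumEmbedding X) := by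
  refine mem_vanishingIdeal_iff.2 fun w hw => ?_
  obtain ⟨p, -, rfl⟩ := mem_affineCone_sumEmbedding.1 hw
  exact aeval_sumRelation_eq_zero.2 (by ext i; cases i using Fin.lastCases <;> simp)

theorem mem_perp_normalSpan_sumEmbedding {p : Fin (n + 1) → ℂ} {w : Fin (n + 2) → ℂ} :
    w ∈ perp (normalSpan (homIdeal (sumEmbedding X)) (sumExt p)) ↔
      ∃ v ∈ perp (normalSpan (homIdeal X) p), w = sumExt v := by
  simp only [mem_perp_normalSpan, homIdeal_sumEmbedding, Ideal.mem_comap]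
  constructor
  · intro h
    have w_eq := gradient_sumRelation_dotProduct_eq_zero.1 (h (sumRelation n) (by
      rw [← Ideal.mem_comap, ← homIdeal_sumEmbedding]
      exact sumRelation_mem_homIdeal_sumEmbedding))
    refine ⟨_, fun f hf => ?_, w_eq⟩
    rw [← sumSubst_rename_castSucc f, gradient_sumSubst, ← dotProduct_sumExt, ← w_eq]
    exact h _ (by rwa [sumSubst_rename_castSucc])
  · rintro ⟨v, hv, rfl⟩ h hh
    rw [dotProduct_sumExt, ← gradient_sumSubst]
    exact hv _ hh

theorem normalSpan_sumEmbedding (p : Fin (n + 1) → ℂ) :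
    normalSpan (homIdeal (sumEmbedding X)) (sumExt p) =
      (normalSpan (homIdeal X) p).comap shiftVec := by
  ext b
  rw [Submodule.mem_comap, ← perp_perp (normalSpan _ (sumExt p)), ← perp_perp (normalSpan _ p)]
  simp only [mem_perp (W := perp _), mem_perp_normalSpan_sumEmbedding, dotProduct_comm _ b,
    dotProduct_comm _ (shiftVec b), ← dotProduct_sumExt]
  exact ⟨fun h v hv => h _ ⟨v, hv, rfl⟩, fun h w ⟨v, hv, hw⟩ => hw ▸ h v hv⟩

theorem mem_conormalCone_sumEmbedding {w b : Fin (n + 2) → ℂ} :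
    Sum.elim w b ∈ conormalCone (affineCone (sumEmbedding X)) ↔
      ∃ p, w = sumExt p ∧ Sum.elim p (shiftVec b) ∈ conormalCone (affineCone X) := by
  simp only [mem_conormalCone, mem_affineCone_sumEmbedding]
  constructor
  · rintro ⟨⟨p, hp, rfl⟩, hb⟩
    exact ⟨p, rfl, hp, (normalSpan_sumEmbedding p).le hb⟩
  · rintro ⟨p, rfl, hp, hb⟩
    exact ⟨⟨p, hp, rfl⟩, (normalSpan_sumEmbedding p).ge hb⟩

theorem aeval_shiftVec_eq_zero {w b : Fin (n + 2) → ℂ}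
    (h : ∀ F ∈ conormalIdeal (affineCone (sumEmbedding X)), aeval (Sum.elim w b) F = 0)
    {F : MvPolynomial (Fin (n + 1) ⊕ Fin (n + 1)) ℂ} (hF : F ∈ conormalIdeal (affineCone X)) :
    aeval (Sum.elim (w ∘ Fin.castSucc) (shiftVec b)) F = 0 := by
  let φ : Fin (n + 1) ⊕ Fin (n + 1) → MvPolynomial (Fin (n + 2) ⊕ Fin (n + 2)) ℂ :=
    Sum.elim (fun i => MvPolynomial.X (Sum.inl i.castSucc))
      (shiftVec fun i => MvPolynomial.X (Sum.inr i))
  have aeval_φ (z : Fin (n + 2) ⊕ Fin (n + 2) → ℂ) : (fun i => aeval z (φ i)) =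
      Sum.elim (z ∘ Sum.inl ∘ Fin.castSucc) (shiftVec (z ∘ Sum.inr)) := by
    ext (i | i) <;> simp [φ, shiftVec_apply]
  have vanishes := aeval_eq_zero_of_mapsTo φ (fun z hz => ?_) h hF
  · rwa [aeval_φ] at vanishes
  · rw [← Sum.elim_comp_inl_inr z] at hz
    obtain ⟨p, hzp, hp⟩ := mem_conormalCone_sumEmbedding.1 hz
    rwa [aeval_φ, ← Function.comp_assoc, hzp, sumExt_comp_castSucc]

theorem aeval_sumExt_eq_zero {p : Fin (n + 1) → ℂ} {b : Fin (n + 2) → ℂ}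
    (h : ∀ F ∈ conormalIdeal (affineCone X), aeval (Sum.elim p (shiftVec b)) F = 0)
    {F : MvPolynomial (Fin (n + 2) ⊕ Fin (n + 2)) ℂ}
    (hF : F ∈ conormalIdeal (affineCone (sumEmbedding X))) :
    aeval (Sum.elim (sumExt p) b) F = 0 := by
  let lift (q : Fin (n + 1) → ℂ) : Fin (n + 2) → ℂ :=
    Fin.snoc (α := fun _ => ℂ) (fun i => q i - b (Fin.last (n + 1))) (b (Fin.last (n + 1)))
  have shiftVec_lift (q : Fin (n + 1) → ℂ) : shiftVec (lift q) = q := by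
    ext i
    simp [lift, shiftVec_apply]
  have lift_shiftVec : lift (shiftVec b) = b := by
    ext i
    cases i using Fin.lastCases <;> simp [lift, shiftVec_apply]
  let φ : Fin (n + 2) ⊕ Fin (n + 2) → MvPolynomial (Fin (n + 1) ⊕ Fin (n + 1)) ℂ :=
    Sum.elim (sumExt fun i => MvPolynomial.X (Sum.inl i))
      (Fin.snoc (α := fun _ => MvPolynomial _ ℂ)
        (fun i => MvPolynomial.X (Sum.inr i) - C (b (Fin.last (n + 1))))
        (C (b (Fin.last (n + 1)))))
  have aeval_φ (p q : Fin (n + 1) → ℂ) : (fun i => aeval (Sum.elim p q) (φ i)) =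
      Sum.elim (sumExt p) (lift q) := by
    ext (i | i) <;> cases i using Fin.lastCases <;> simp [φ, lift]
  have vanishes := aeval_eq_zero_of_mapsTo φ (fun z hz => ?_) h hF
  · rwa [aeval_φ, lift_shiftVec] at vanishes
  · rw [← Sum.elim_comp_inl_inr z] at hz ⊢
    rw [aeval_φ, mem_conormalCone_sumEmbedding]
    exact ⟨_, rfl, by rwa [shiftVec_lift]⟩

theorem forall_conormalIdeal_sumEmbedding_iff {w b : Fin (n + 2) → ℂ} :
    (∀ F ∈ conormalIdeal (affineCone (sumEmbedding X)), aeval (Sum.elim w b) F = 0) ↔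
      ∃ p, w = sumExt p ∧
        ∀ F ∈ conormalIdeal (affineCone X), aeval (Sum.elim p (shiftVec b)) F = 0 := by
  refine ⟨fun h => ⟨w ∘ Fin.castSucc, ?_, fun F => aeval_shiftVec_eq_zero h⟩, ?_⟩
  · have vanishes := h _ (rename_inl_mem_conormalIdeal.2 sumRelation_mem_homIdeal_sumEmbedding)
    rwa [aeval_rename, Sum.elim_comp_inl, aeval_sumRelation_eq_zero] at vanishes
  · rintro ⟨p, rfl, h⟩ F
    exact aeval_sumExt_eq_zero h

end SumEmbedding

section GenericData

theorem exists_eval₂_aeval_eq_zero {k L ι : Type*} [Field k] [Field L] [Algebra k L] [Finite ι]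
    (hι : Algebra.trdeg k L ≤ Nat.card ι) (w : ι → L) {φ : L} (hφ : φ ≠ 0) :
    ∃ G : Polynomial (MvPolynomial ι k), G.coeff 0 ≠ 0 ∧
      G.eval₂ (aeval w : MvPolynomial ι k →ₐ[k] L).toRingHom φ = 0 := by
  have dependent : ¬AlgebraicIndependent k (fun o : Option ι => o.elim φ w) := by
    intro h
    have card_le := h.lift_cardinalMk_le_trdeg
    rw [← Nat.cast_card (α := Option ι), Cardinal.lift_natCast, Finite.card_option] at card_le
    have card_succ_le := card_le.trans (Cardinal.lift_le.2 hι)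
    rw [Cardinal.lift_natCast, Nat.cast_le] at card_succ_le
    omega
  rw [algebraicIndependent_iff] at dependent
  push Not at dependent
  obtain ⟨H, aeval_H, H_ne_zero⟩ := dependent
  have eval₂_H : (optionEquivLeft k ι H).eval₂ (aeval w : MvPolynomial ι k →ₐ[k] L).toRingHom φ =
      0 := by
    have algHom_eq : ((Polynomial.eval₂AlgHom (aeval w : MvPolynomial ι k →ₐ[k] L) φ
        fun _ => Commute.all _ _).comp (optionEquivLeft k ι).toAlgHom) =
        aeval fun o : Option ι => o.elim φ w := by
      ext o
      cases o <;> simp [optionEquivLeft_apply]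
    exact (DFunLike.congr_fun algHom_eq H).trans aeval_H
  obtain ⟨G, H_eq, X_not_dvd⟩ := Polynomial.exists_eq_pow_rootMultiplicity_mul_and_not_dvd
    (optionEquivLeft k ι H) (by simpa using H_ne_zero) 0
  refine ⟨G, fun h => X_not_dvd (by simpa using Polynomial.X_dvd_iff.2 h), ?_⟩
  rw [H_eq, Polynomial.eval₂_mul, Polynomial.eval₂_pow] at eval₂_H
  simpa [hφ] using eval₂_H

variable {k : Type*} [Field k]

theorem eval_map_optionEquivLeft {ι : Type*} (G : MvPolynomial (Option ι) k) (u : ι → k) (s : k) :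
    ((optionEquivLeft k ι G).map (aeval u : MvPolynomial ι k →ₐ[k] k).toRingHom).eval s =
      aeval (fun o : Option ι => o.elim s u) G := by
  have ringHom_eq : (Polynomial.evalRingHom s).comp ((Polynomial.mapRingHom
      (aeval u : MvPolynomial ι k →ₐ[k] k).toRingHom).comp
        (optionEquivLeft k ι : MvPolynomial (Option ι) k →+* _)) =
      (aeval fun o : Option ι => o.elim s u : MvPolynomial (Option ι) k →ₐ[k] k).toRingHom := by
    refine MvPolynomial.ringHom_ext (fun a => by simp) ?_
    rintro (_ | _) <;> simp
  exact DFunLike.congr_fun ringHom_eq G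

theorem exists_aeval_eq_zero_of_forall_option [Infinite k] {ι : Type*}
    {G : MvPolynomial (Option ι) k} (hG : G ≠ 0) :
    ∃ F : MvPolynomial ι k, F ≠ 0 ∧ ∀ u : ι → k,
      (∀ s ≠ 0, aeval (fun o : Option ι => o.elim s u) G = 0) → aeval u F = 0 := by
  let H := optionEquivLeft k ι G
  have H_ne_zero : H ≠ 0 := (map_ne_zero_iff _ (optionEquivLeft k ι).injective).2 hG
  refine ⟨H.leadingCoeff, Polynomial.leadingCoeff_ne_zero.2 H_ne_zero, fun u hu => ?_⟩
  have map_eq_zero : H.map (aeval u : MvPolynomial ι k →ₐ[k] k).toRingHom = 0 :=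
    Polynomial.eq_zero_of_infinite_isRoot _ ((Set.finite_singleton 0).infinite_compl.mono
      fun s hs => (eval_map_optionEquivLeft G u s).trans (hu s hs))
  simpa [Polynomial.coeff_map] using congrArg (Polynomial.coeff · H.natDegree) map_eq_zero

variable {n : ℕ}

/-- The substitution `u_i = p_i b_i`, which pulls functions of `(u, b)` back to pairs `(p, b)`. -/
def productSubst (k : Type*) [Field k] (n : ℕ) :
    MvPolynomial (Fin (n + 1) ⊕ Fin (n + 2)) k →ₐ[k] MvPolynomial (Fin (n + 2) ⊕ Fin (n + 2)) k :=
  aeval (Sum.elim (fun i => X (Sum.inl i.castSucc) * X (Sum.inr i.castSucc)) fun i => X (Sum.inr i))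

theorem aeval_productSubst {E : Type*} [CommRing E] [Algebra k E] (p b : Fin (n + 2) → E)
    (Φ : MvPolynomial (Fin (n + 1) ⊕ Fin (n + 2)) k) :
    aeval (Sum.elim p b) (productSubst k n Φ) =
      aeval (Sum.elim (fun i : Fin (n + 1) => p i.castSucc * b i.castSucc) b) Φ := by
  rw [productSubst, comp_aeval_apply]
  congr 2
  ext (i | i) <;> simp

/-- The equations of the closure of the set of pairs `(u, b)` such that `u_i = p_i b_i` for some
`(p, b)` in the conormal variety of `V`. -/
def likelihoodIdeal (V : Set (Fin (n + 2) → k)) :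
    Ideal (MvPolynomial (Fin (n + 1) ⊕ Fin (n + 2)) k) :=
  (conormalIdeal V).comap (productSubst k n)

variable {V : Set (Fin (n + 2) → k)} {u : Fin (n + 1) → k} {b p : Fin (n + 2) → k}

theorem mem_likelihoodIdeal_iff {Φ : MvPolynomial (Fin (n + 1) ⊕ Fin (n + 2)) k} :
    Φ ∈ likelihoodIdeal V ↔ ∀ p b, Sum.elim p b ∈ conormalCone V →
      aeval (Sum.elim (fun i : Fin (n + 1) => p i.castSucc * b i.castSucc) b) Φ = 0 := by
  rw [likelihoodIdeal, Ideal.mem_comap, conormalIdeal, mem_vanishingIdeal_iff]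
  simp only [← aeval_productSubst]
  exact ⟨fun h p b => h _, fun h z hz => by
    rw [← Sum.elim_comp_inl_inr z] at hz ⊢
    exact h _ _ hz⟩

theorem aeval_eq_zero_of_mem_likelihoodIdeal
    (hpb : ∀ F ∈ conormalIdeal V, aeval (Sum.elim p b) F = 0)
    (hu : ∀ i : Fin (n + 1), p i.castSucc * b i.castSucc = u i)
    {Φ : MvPolynomial (Fin (n + 1) ⊕ Fin (n + 2)) k} (hΦ : Φ ∈ likelihoodIdeal V) :
    aeval (Sum.elim u b) Φ = 0 := by
  rw [← hpb _ (Ideal.mem_comap.1 hΦ), aeval_productSubst]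
  simp only [hu]

theorem aeval_smul_eq_zero_of_mem_likelihoodIdeal [Infinite k] (hV : ∀ t : k, ∀ v ∈ V, t • v ∈ V)
    (h : ∀ Φ ∈ likelihoodIdeal V, aeval (Sum.elim u b) Φ = 0) {t : k} (ht : t ≠ 0)
    {Φ : MvPolynomial (Fin (n + 1) ⊕ Fin (n + 2)) k} (hΦ : Φ ∈ likelihoodIdeal V) :
    aeval (Sum.elim u (t • b)) Φ = 0 := by
  let scaling : Fin (n + 1) ⊕ Fin (n + 2) → MvPolynomial (Fin (n + 1) ⊕ Fin (n + 2)) k :=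
    Sum.elim (fun i => X (Sum.inl i)) fun i => C t * X (Sum.inr i)
  have aeval_scaling (u : Fin (n + 1) → k) (b : Fin (n + 2) → k) :
      aeval (Sum.elim u b) (aeval scaling Φ) = aeval (Sum.elim u (t • b)) Φ := by
    rw [aeval_aeval]
    congr 2
    ext (i | i) <;> simp [scaling]
  rw [← aeval_scaling]
  refine h _ (mem_likelihoodIdeal_iff.2 fun p b hpb => ?_)
  -- The products `p i * b i` do not change when `(p, b)` is replaced by `(t⁻¹ p, t b)`.
  have scaled := mem_likelihoodIdeal_iff.1 hΦ _ _
    (smul_smul_mem_conormalCone (s := t) hV (inv_ne_zero ht) hpb)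
  rw [aeval_scaling, ← scaled]
  congr 3
  ext i
  simp only [Pi.smul_apply, smul_eq_mul]
  field_simp

/-- The polynomial in `(u, b)` obtained from a polynomial in one variable with coefficients in
`k[s, u]` by putting `s = b j` and replacing the variable by `f(b)`. -/
def relationPolynomial (G : Polynomial (MvPolynomial (Option (Fin (n + 1))) k))
    (f : MvPolynomial (Fin (n + 2)) k) (j : Fin (n + 2)) :
    MvPolynomial (Fin (n + 1) ⊕ Fin (n + 2)) k :=
  G.eval₂ (aeval fun o : Option (Fin (n + 1)) => o.elim (X (Sum.inr j)) fun i => X (Sum.inl i) :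
    MvPolynomial (Option (Fin (n + 1))) k →ₐ[k] _).toRingHom (rename Sum.inr f)

theorem aeval_relationPolynomial {E : Type*} [CommRing E] [Algebra k E]
    (G : Polynomial (MvPolynomial (Option (Fin (n + 1))) k)) (f : MvPolynomial (Fin (n + 2)) k)
    (j : Fin (n + 2)) (u : Fin (n + 1) → E) (b : Fin (n + 2) → E) :
    aeval (Sum.elim u b) (relationPolynomial G f j) =
      G.eval₂ (aeval fun o : Option (Fin (n + 1)) => o.elim (b j) u :
        MvPolynomial (Option (Fin (n + 1))) k →ₐ[k] E).toRingHom (aeval b f) := by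
  have aeval_rename_inr : (aeval (Sum.elim u b) : MvPolynomial _ k →ₐ[k] E).toRingHom
      (rename Sum.inr f) = aeval b f := by
    rw [AlgHom.toRingHom_eq_coe, RingHom.coe_coe, aeval_rename, Sum.elim_comp_inr]
  refine (Polynomial.hom_eval₂ G _ (aeval (Sum.elim u b)).toRingHom _).trans ?_
  rw [aeval_rename_inr]
  congr 1
  refine MvPolynomial.ringHom_ext (fun a => by simp [MvPolynomial.algebraMap_eq]) ?_
  rintro (_ | _) <;> simp

variable [CharZero k] {f : MvPolynomial (Fin (n + 2)) k} {d : ℕ}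

theorem trdeg_functionField_conormalIdeal {σ : Type*} [Fintype σ] (V : Set (σ → k))
    [(vanishingIdeal k V).IsPrime] [(conormalIdeal V).IsPrime] :
    Algebra.trdeg k (FunctionField (conormalIdeal V)) = Fintype.card σ := by
  obtain ⟨d, x, basis, dim_eq⟩ := exists_isTranscendenceBasis_ringKrullDim_eq k
    (MvPolynomial (σ ⊕ σ) k ⧸ conormalIdeal V) (FunctionField (conormalIdeal V))
  rw [ringKrullDim_quotient_conormalIdeal V] at dim_eq
  have card_eq : Fintype.card σ = d := by exact_mod_cast dim_eq
  simpa [card_eq] using basis.lift_cardinalMk_eq_trdeg.symm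

/-- The `u_i = p_i b_i` and `b_j` together are as many as the dimension of the conormal variety, so
that `f` satisfies a relation over them; after scaling, `b_j` is arbitrary. -/
theorem exists_aeval_eq_zero_of_apply_ne_zero (hV : IsIrreducibleCone V)
    (hf : rename Sum.inr f ∉ conormalIdeal V) (hhom : f.IsHomogeneous d) (j : Fin (n + 2)) :
    ∃ F : MvPolynomial (Fin (n + 1)) k, F ≠ 0 ∧ ∀ (u : Fin (n + 1) → k) (b : Fin (n + 2) → k),
      b j ≠ 0 → (∀ Φ ∈ likelihoodIdeal V, aeval (Sum.elim u b) Φ = 0) → aeval b f = 0 →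
        aeval u F = 0 := by
  have := hV.prime
  have := isPrime_conormalIdeal V
  let p := genericPoint (conormalIdeal V) ∘ Sum.inl
  let q := genericPoint (conormalIdeal V) ∘ Sum.inr
  have elim_eq : Sum.elim p q = genericPoint (conormalIdeal V) := Sum.elim_comp_inl_inr _
  have f_ne_zero : aeval q f ≠ 0 := by
    rwa [← aeval_rename, Ne, aeval_genericPoint_eq_zero]
  have trdeg_le : Algebra.trdeg k (FunctionField (conormalIdeal V)) ≤
      Nat.card (Option (Fin (n + 1))) := by
    simp [trdeg_functionField_conormalIdeal, add_assoc, one_add_one_eq_two]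
  obtain ⟨G, coeff_ne_zero, eval₂_G⟩ := exists_eval₂_aeval_eq_zero trdeg_le
    (fun o : Option (Fin (n + 1)) => o.elim (q j) fun i => p i.castSucc * q i.castSucc) f_ne_zero
  obtain ⟨F, F_ne_zero, hF⟩ := exists_aeval_eq_zero_of_forall_option coeff_ne_zero
  refine ⟨F, F_ne_zero, fun u b hb hub hfb => hF u fun s hs => ?_⟩
  have relation_mem : relationPolynomial G f j ∈ likelihoodIdeal V := by
    rw [likelihoodIdeal, Ideal.mem_comap, ← aeval_genericPoint_eq_zero, ← elim_eq,
      aeval_productSubst, aeval_relationPolynomial]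
    exact eval₂_G
  have relation := aeval_smul_eq_zero_of_mem_likelihoodIdeal hV.smul_mem hub (div_ne_zero hs hb)
    relation_mem
  rwa [aeval_relationPolynomial, aeval_smul_of_isHomogeneous hhom, hfb, mul_zero,
    Polynomial.eval₂_at_zero, Pi.smul_apply, smul_eq_mul, div_mul_cancel₀ s hb] at relation

/-- The data `u` is generic with respect to `f`: over `u`, the zeros of the likelihood ideal lie
outside the hypersurface `f = 0`. -/
def IsGenericData (V : Set (Fin (n + 2) → k)) (f : MvPolynomial (Fin (n + 2)) k)
    (u : Fin (n + 1) → k) : Prop :=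
  ∀ b : Fin (n + 2) → k, b ≠ 0 →
    (∀ Φ ∈ likelihoodIdeal V, aeval (Sum.elim u b) Φ = 0) → aeval b f ≠ 0

theorem exists_forall_isGenericData (hV : IsIrreducibleCone V)
    (hf : rename Sum.inr f ∉ conormalIdeal V) (hhom : f.IsHomogeneous d) :
    ∃ F : MvPolynomial (Fin (n + 1)) k, F ≠ 0 ∧ ∀ u, aeval u F ≠ 0 → IsGenericData V f u := by
  choose F F_ne_zero hF using exists_aeval_eq_zero_of_apply_ne_zero hV hf hhom
  refine ⟨∏ j, F j, Finset.prod_ne_zero_iff.2 fun j _ => F_ne_zero j,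
    fun u hu b hb hub hfb => hu ?_⟩
  obtain ⟨j, hj⟩ := Function.ne_iff.1 hb
  rw [map_prod]
  exact Finset.prod_eq_zero (Finset.mem_univ j) (hF j u b hj hub hfb)

end GenericData

section Saturation

variable {R : Type} [CommRing R] {I J : Ideal R}

theorem le_saturation (I J : Ideal R) : I ≤ saturation I J :=
  le_trans (fun _ hf => Submodule.mem_colon.2 fun _ _ => Ideal.mul_mem_right _ _ hf)
    (le_iSup (fun N => Submodule.colon I ((J ^ N : Ideal R) : Set R)) 0)

theorem saturation_le_of_isPrime {P : Ideal R} [P.IsPrime] (hIP : I ≤ P) {y : R} (hy : y ∈ J)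
    (hyP : y ∉ P) : saturation I J ≤ P := by
  refine iSup_le fun N f hf => ?_
  have mul_mem := hIP (Submodule.mem_colon.1 hf (y ^ N) (Ideal.pow_mem_pow hy N))
  exact (Ideal.IsPrime.mem_or_mem ‹_› mul_mem).resolve_right
    fun h => hyP (Ideal.IsPrime.mem_of_pow_mem ‹_› N h)

theorem mem_radical_saturation [IsNoetherianRing R] {f : R} (hf : ∀ y ∈ J, f * y ∈ I.radical) :
    f ∈ (saturation I J).radical := by
  have mul_le : Ideal.span {f} * J ≤ I.radical := Ideal.span_singleton_mul_le_iff.2 hf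
  obtain ⟨N, pow_le⟩ := Ideal.exists_radical_pow_le_of_fg I (IsNoetherian.noetherian _)
  refine ⟨N, Submodule.mem_iSup_of_mem N (Submodule.mem_colon.2 fun y hy => ?_)⟩
  refine pow_le (Ideal.pow_right_mono mul_le N ?_)
  rw [mul_pow, Ideal.span_singleton_pow]
  exact Ideal.mul_mem_mul (Ideal.mem_span_singleton_self _) hy

variable {k τ : Type} [Field k] {I J : Ideal (MvPolynomial τ k)} {b : τ → k}

theorem aeval_eq_zero_of_mem_saturation (hI : ∀ f ∈ I, aeval b f = 0)
    {y : MvPolynomial τ k} (hy : y ∈ J) (hyb : aeval b y ≠ 0) {f : MvPolynomial τ k}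
    (hf : f ∈ saturation I J) : aeval b f = 0 :=
  have : (RingHom.ker (aeval b : MvPolynomial τ k →ₐ[k] k)).IsPrime := RingHom.ker_isPrime _
  saturation_le_of_isPrime (P := RingHom.ker (aeval b : MvPolynomial τ k →ₐ[k] k)) hI hy hyb hf

theorem aeval_eq_zero_of_forall_saturation [IsAlgClosed k] [Finite τ] {f : MvPolynomial τ k}
    (hf : ∀ b : τ → k, (∀ h ∈ I, aeval b h = 0) → ∀ y ∈ J, aeval b y ≠ 0 → aeval b f = 0)
    (hb : ∀ h ∈ saturation I J, aeval b h = 0) : aeval b f = 0 := by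
  obtain ⟨N, pow_mem⟩ : f ∈ (saturation I J).radical := by
    refine mem_radical_saturation fun y hy => ?_
    rw [← MvPolynomial.vanishingIdeal_zeroLocus_eq_radical (K := k) I, mem_vanishingIdeal_iff]
    intro z hz
    rw [map_mul, mul_eq_zero, or_iff_not_imp_right]
    exact hf z (fun h hh => mem_zeroLocus_iff.1 hz h hh) y hy
  exact eq_zero_of_pow_eq_zero ((map_pow _ _ _).symm.trans (hb _ pow_mem))

end Saturation

section DefiningEquations

theorem gradient_sum {σ k E ι : Type*} [CommRing k] [CommRing E] [Algebra k E] (y : σ → E)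
    (s : Finset ι) (f : ι → MvPolynomial σ k) :
    gradient y (∑ j ∈ s, f j) = ∑ j ∈ s, gradient y (f j) := by
  ext i
  simp [gradient]

theorem gradient_mul_mem_span {σ k E : Type*} [CommRing k] [Field E] [Algebra k E] {y : σ → E}
    {ι : Type*} [Finite ι] {g : ι → MvPolynomial σ k} (hg : ∀ j, aeval y (g j) = 0)
    {f h : MvPolynomial σ k} (hf : aeval y f = 0) (hh : aeval y h ≠ 0)
    (hfg : h * f ∈ Ideal.span (Set.range g)) :
    gradient y f ∈ Submodule.span E (Set.range fun j => gradient y (g j)) := by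
  have := Fintype.ofFinite ι
  obtain ⟨a, ha⟩ := Ideal.mem_span_range_iff_exists_fun.1 hfg
  have gradient_left : gradient y (h * f) = aeval y h • gradient y f := by
    rw [gradient_mul, hf, zero_smul, add_zero]
  have gradient_right : gradient y (h * f) = ∑ j, aeval y (a j) • gradient y (g j) := by
    rw [← ha, gradient_sum]
    refine Finset.sum_congr rfl fun j _ => ?_
    rw [gradient_mul, hg, zero_smul, add_zero]
  rw [← Submodule.smul_mem_iff _ hh, ← gradient_left, gradient_right]
  exact Submodule.sum_mem _ fun j _ => Submodule.smul_mem _ _ (Submodule.subset_span ⟨j, rfl⟩)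

variable {σ : Type} {l c : ℕ} {g : Fin l → MvPolynomial σ ℂ} {Y : Set (ProjSpace σ)}

namespace DefinesVariety

theorem mem_affineCone_iff (hg : DefinesVariety g Y) {v : σ → ℂ} :
    v ∈ affineCone Y ↔ ∀ j, aeval v (g j) = 0 := by
  rw [← hg.zeros]
  rfl

theorem mem_homIdeal (hg : DefinesVariety g Y) (j : Fin l) : g j ∈ homIdeal Y :=
  mem_vanishingIdeal_iff.2 fun _ hv => hg.mem_affineCone_iff.1 hv j

theorem span_gradient_genericPoint (hg : DefinesVariety g Y) [(homIdeal Y).IsPrime] :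
    Submodule.span (FunctionField (homIdeal Y))
        (Set.range fun j => gradient (genericPoint (homIdeal Y)) (g j)) =
      normalSpan (homIdeal Y) (genericPoint (homIdeal Y)) := by
  obtain ⟨h, h_notMem, mul_mem⟩ := hg.genericallyReduced
  refine le_antisymm (Submodule.span_le.2 ?_) (normalSpan_le.2 fun f hf => ?_)
  · rintro _ ⟨j, rfl⟩
    exact gradient_mem_normalSpan _ (hg.mem_homIdeal j)
  · exact gradient_mul_mem_span (y := genericPoint (homIdeal Y))
      (fun j => (aeval_genericPoint_eq_zero (homIdeal Y)).2 (hg.mem_homIdeal j))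
      ((aeval_genericPoint_eq_zero (homIdeal Y)).2 hf)
      (fun h0 => h_notMem ((aeval_genericPoint_eq_zero (homIdeal Y)).1 h0)) (mul_mem f hf)

theorem exists_isJacobianChart [Fintype σ] (hg : DefinesVariety g Y) [hY : (homIdeal Y).IsPrime]
    (hc : HasCodim Y c) :
    ∃ (a : Fin c → Fin l) (s : Fin c → σ), IsJacobianChart (affineCone Y) (g ∘ a) s := by
  have : (vanishingIdeal ℂ (affineCone Y)).IsPrime := hY
  obtain ⟨r, a, s, chart⟩ :=
    DualMLE.exists_isJacobianChart hg.mem_homIdeal hg.span_gradient_genericPoint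
  obtain rfl : r = c := by
    obtain ⟨d, -, -, hd⟩ := exists_isTranscendenceBasis_ringKrullDim_eq ℂ
      (MvPolynomial σ ℂ ⧸ homIdeal Y) (FunctionField (homIdeal Y))
    have add_r : ringKrullDim (MvPolynomial σ ℂ ⧸ homIdeal Y) + r = Fintype.card σ :=
      chart.ringKrullDim_add
    have add_c : ringKrullDim (MvPolynomial σ ℂ ⧸ homIdeal Y) + c = Fintype.card σ := hc
    rw [hd] at add_r add_c
    have add_eq : d + r = d + c := by exact_mod_cast add_r.trans add_c.symm
    exact Nat.add_left_cancel add_eq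
  exact ⟨a, s, chart⟩

end DefinesVariety

end DefiningEquations

section CriticalEquations

theorem mem_span_of_minors_eq_zero {K κ m : Type*} [Field K] [LinearOrder κ] [LinearOrder m]
    [Finite m] {c : ℕ} {M : Matrix κ m K}
    (hM : ∀ (r : Fin (c + 1) ↪o κ) (s : Fin (c + 1) ↪o m), (M.submatrix r s).det = 0)
    {a : Fin c → κ} (ha : LinearIndependent K fun j => M (a j)) (i : κ) :
    M i ∈ Submodule.span K (Set.range fun j => M (a j)) := by
  by_contra hi
  have linearIndependent : LinearIndependent K
      (M.submatrix (Fin.cons i a : Fin (c + 1) → κ) id).row := by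
    convert! linearIndependent_finCons.2 ⟨ha, hi⟩ using 1
    ext j
    cases j using Fin.cases <;> rfl
  obtain ⟨s, det_ne_zero⟩ := exists_submatrix_det_ne_zero linearIndependent
  obtain ⟨r', s', notMem⟩ := exists_orderEmbedding_det_notMem M (I := ⊥) det_ne_zero
  exact notMem (hM r' s')

theorem minorsIdeal_le_ker_iff {R S : Type} [CommRing R] [CommRing S] {a b c : ℕ}
    {M : Matrix (Fin a) (Fin b) R} {φ : R →+* S} :
    minorsIdeal c M ≤ RingHom.ker φ ↔
      ∀ (r : Fin c ↪o Fin a) (s : Fin c ↪o Fin b), ((M.map φ).submatrix r s).det = 0 := by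
  have map_minor (r : Fin c ↪o Fin a) (s : Fin c ↪o Fin b) :
      φ (M.submatrix r s).det = ((M.map φ).submatrix r s).det := φ.map_det _
  rw [minorsIdeal, Ideal.span_le]
  constructor
  · intro h r s
    exact (map_minor r s).symm.trans (h ⟨r, s, rfl⟩)
  · rintro h _ ⟨r, s, rfl⟩
    exact (map_minor r s).trans (h r s)

variable {n l c : ℕ}

theorem aeval_shift (b : Fin (n + 2) → ℂ) (f : MvPolynomial (Fin (n + 1)) ℂ) :
    aeval b (shift n f) = aeval (shiftVec b) f := by
  rw [shift, comp_aeval_apply]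
  congr 2
  ext i
  rw [map_add, aeval_X, aeval_X, shiftVec_apply]

theorem isHomogeneous_shift {f : MvPolynomial (Fin (n + 1)) ℂ} {d : ℕ} (hf : f.IsHomogeneous d) :
    (shift n f).IsHomogeneous d := by
  rw [← one_mul d]
  exact hf.aeval _ fun i => (isHomogeneous_X _ _).add (isHomogeneous_X _ _)

variable {g : Fin l → MvPolynomial (Fin (n + 1)) ℂ} {u p : Fin (n + 1) → ℂ} {b : Fin (n + 2) → ℂ}

theorem map_shiftedJacobian :
    (shiftedJacobian g).map (aeval b : MvPolynomial _ ℂ →ₐ[ℂ] ℂ).toRingHom =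
      Matrix.of fun j => gradient (shiftVec b) (g j) := by
  ext j i
  exact aeval_shift b _

theorem map_extendedJacobian :
    (extendedJacobian g u).map (aeval b : MvPolynomial _ ℂ →ₐ[ℂ] ℂ).toRingHom =
      Matrix.of (Fin.cons u fun j => gradient (shiftVec b) (g j) * (b ∘ Fin.castSucc)) := by
  ext j i
  cases j using Fin.cases with
  | zero => exact aeval_C b (u i)
  | succ j =>
    calc aeval b (extendedJacobian g u j.succ i)
        = aeval b (shiftedJacobian g j i * X i.castSucc) :=
          congrArg (aeval b) (Matrix.mul_diagonal _ (shiftedJacobian g) j i)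
      _ = gradient (shiftVec b) (g j) i * b i.castSucc := by
          rw [map_mul, aeval_X]
          exact congrArg (· * _) (aeval_shift b _)

/-- The ideal `I_u` of the dual likelihood equations before saturation. -/
def criticalIdeal (g : Fin l → MvPolynomial (Fin (n + 1)) ℂ) (c : ℕ) (u : Fin (n + 1) → ℂ) :
    Ideal (MvPolynomial (Fin (n + 2)) ℂ) :=
  Ideal.span (Set.range fun j => shift n (g j)) ⊔ minorsIdeal (c + 1) (extendedJacobian g u)

/-- The ideal `(b_0 ⋯ b_n b_s) S` by which the ideal of the dual likelihood equations is
saturated. -/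
def exceptionalIdeal (g : Fin l → MvPolynomial (Fin (n + 1)) ℂ) (c : ℕ) :
    Ideal (MvPolynomial (Fin (n + 2)) ℂ) :=
  Ideal.span {∏ i : Fin (n + 2), X i} * minorsIdeal c (shiftedJacobian g)

theorem forall_criticalIdeal_iff :
    (∀ f ∈ criticalIdeal g c u, aeval b f = 0) ↔
      (∀ j, aeval (shiftVec b) (g j) = 0) ∧
        ∀ (r : Fin (c + 1) ↪o Fin (l + 1)) (s : Fin (c + 1) ↪o Fin (n + 1)),
          ((Matrix.of (Fin.cons u fun j => gradient (shiftVec b) (g j) * (b ∘ Fin.castSucc)) :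
            Matrix (Fin (l + 1)) (Fin (n + 1)) ℂ).submatrix r s).det = 0 := by
  change criticalIdeal g c u ≤
    RingHom.ker (aeval b : MvPolynomial (Fin (n + 2)) ℂ →ₐ[ℂ] ℂ).toRingHom ↔ _
  rw [criticalIdeal, sup_le_iff, Ideal.span_le, Set.range_subset_iff, minorsIdeal_le_ker_iff,
    map_extendedJacobian]
  simp only [← aeval_shift]
  rfl

theorem exists_exceptionalIdeal_aeval_ne_zero_iff :
    (∃ y ∈ exceptionalIdeal g c, aeval b y ≠ 0) ↔ (∀ i, b i ≠ 0) ∧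
      ∃ (a : Fin c → Fin l) (s : Fin c → Fin (n + 1)),
        aeval (shiftVec b) (jacobianMinor (g ∘ a) s) ≠ 0 := by
  have aeval_prod_ne_zero : aeval b (∏ i, X i : MvPolynomial (Fin (n + 2)) ℂ) ≠ 0 ↔
      ∀ i, b i ≠ 0 := by
    simp [Finset.prod_ne_zero_iff]
  simp only [aeval_jacobianMinor]
  constructor
  · rintro ⟨y, hy, hyb⟩
    obtain ⟨δ, δ_mem, rfl⟩ := Ideal.mem_span_singleton_mul.1 hy
    rw [map_mul, mul_ne_zero_iff, aeval_prod_ne_zero] at hyb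
    refine ⟨hyb.1, ?_⟩
    by_contra! minors_eq_zero
    refine hyb.2 (minorsIdeal_le_ker_iff
      (φ := (aeval b : MvPolynomial (Fin (n + 2)) ℂ →ₐ[ℂ] ℂ).toRingHom).2 (fun r s => ?_) δ_mem)
    rw [map_shiftedJacobian]
    exact minors_eq_zero r s
  · rintro ⟨b_ne_zero, a, s, hdet⟩
    obtain ⟨r', s', hdet'⟩ := exists_orderEmbedding_det_notMem (I := ⊥)
      (Matrix.of fun j => gradient (shiftVec b) (g j)) (r := a) (s := s) hdet
    refine ⟨_, Ideal.mul_mem_mul (Ideal.mem_span_singleton_self _)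
      (Ideal.subset_span ⟨r', s', rfl⟩), ?_⟩
    rw [map_mul, mul_ne_zero_iff, aeval_prod_ne_zero, AlgHom.map_det]
    rw [← map_shiftedJacobian] at hdet'
    exact ⟨b_ne_zero, hdet'⟩

theorem mem_span_gradient_of_forall_criticalIdeal
    (hI : ∀ f ∈ criticalIdeal g c u, aeval b f = 0) (hb : ∀ i, b i ≠ 0)
    {a : Fin c → Fin l} {s : Fin c → Fin (n + 1)}
    (hs : aeval (shiftVec b) (jacobianMinor (g ∘ a) s) ≠ 0) :
    (fun i : Fin (n + 1) => u i / b i.castSucc) ∈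
      Submodule.span ℂ (Set.range fun j => gradient (shiftVec b) (g (a j))) := by
  let D : (Fin (n + 1) → ℂ) →ₗ[ℂ] (Fin (n + 1) → ℂ) := LinearMap.mulRight ℂ (b ∘ Fin.castSucc)
  have D_injective : Function.Injective D := fun v w hvw =>
    _root_.funext fun i => mul_right_cancel₀ (hb i.castSucc) (congr_fun hvw i)
  have D_div : D (fun i => u i / b i.castSucc) = u :=
    _root_.funext fun i => div_mul_cancel₀ (u i) (hb i.castSucc)
  have linearIndependent : LinearIndependent ℂ fun j => D (gradient (shiftVec b) (g (a j))) :=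
    (linearIndependent_of_aeval_jacobianMinor hs).map' D (LinearMap.ker_eq_bot.2 D_injective)
  have u_mem : u ∈ Submodule.span ℂ (Set.range fun j => D (gradient (shiftVec b) (g (a j)))) :=
    mem_span_of_minors_eq_zero (forall_criticalIdeal_iff.1 hI).2
      (a := fun j => (a j).succ) linearIndependent 0
  rw [Set.range_comp' D, ← Submodule.map_span, ← D_div] at u_mem
  exact (D_injective.mem_set_image).1 u_mem

theorem aeval_eq_zero_of_mem_criticalIdeal (hg : ∀ j, aeval (shiftVec b) (g j) = 0)
    {W : Submodule ℂ (Fin (n + 1) → ℂ)} (hW : Module.finrank ℂ W ≤ c)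
    (hgW : ∀ j, gradient (shiftVec b) (g j) ∈ W) (hp : p ∈ W)
    (hpu : ∀ i : Fin (n + 1), p i * b i.castSucc = u i) {f : MvPolynomial (Fin (n + 2)) ℂ}
    (hf : f ∈ criticalIdeal g c u) : aeval b f = 0 := by
  refine forall_criticalIdeal_iff.2 ⟨hg, fun r s => ?_⟩ f hf
  let D : (Fin (n + 1) → ℂ) →ₗ[ℂ] (Fin (n + 1) → ℂ) := LinearMap.mulRight ℂ (b ∘ Fin.castSucc)
  have finrank_lt : Module.finrank ℂ (W.map D) < Fintype.card (Fin (c + 1)) := by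
    rw [Fintype.card_fin]
    exact Nat.lt_succ_of_le ((Submodule.finrank_map_le D W).trans hW)
  have row_mem (j : Fin (l + 1)) :
      (Fin.cons u fun j => gradient (shiftVec b) (g j) * (b ∘ Fin.castSucc) :
        Fin (l + 1) → Fin (n + 1) → ℂ) j ∈ W.map D := by
    cases j using Fin.cases with
    | zero => exact ⟨p, hp, _root_.funext hpu⟩
    | succ j => exact ⟨_, hgW j, rfl⟩
  exact submatrix_det_eq_zero_of_finrank_lt finrank_lt (fun j => row_mem (r j)) s

end CriticalEquations

section CriticalPoints

variable {n l c : ℕ} {X : Set (ProjSpace (Fin (n + 1)))} {u : Fin (n + 1) → ℂ}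

theorem extData_castSucc (u : Fin (n + 1) → ℂ) (i : Fin (n + 1)) : extData u i.castSucc = u i := by
  simp [extData]

theorem extData_last (u : Fin (n + 1) → ℂ) : extData u (Fin.last (n + 1)) = -∑ i, u i := by
  simp [extData]

theorem extData_ne_zero (hu : u ≠ 0) : extData u ≠ 0 := by
  obtain ⟨i, hi⟩ := Function.ne_iff.1 hu
  exact ne_of_apply_ne (· i.castSucc) ((extData_castSucc u i).trans_ne hi)

theorem extData_div_eq_sumExt {b : Fin (n + 2) → ℂ} (hb : ∀ i, b i ≠ 0)
    (h : (fun i : Fin (n + 1) => u i / b i.castSucc) ⬝ᵥ shiftVec b = 0) :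
    (fun i => extData u i / b i) = sumExt fun i => u i / b i.castSucc := by
  rw [dotProduct_comm, ← dotProduct_sumExt, dotProduct, Fin.sum_univ_castSucc] at h
  simp only [sumExt_castSucc, mul_div_cancel₀ _ (hb _)] at h
  ext i
  cases i using Fin.lastCases with
  | cast i => rw [extData_castSucc, sumExt_castSucc]
  | last =>
    rw [extData_last, div_eq_iff (hb _)]
    linear_combination -h

theorem mem_dualLikelihoodLocus_iff (hX : (homIdeal X).IsPrime) (hne : X.Nonempty) (hu : u ≠ 0)
    {x : ProjSpace (Fin (n + 2))} :
    x ∈ dualLikelihoodLocus X u ↔ ∃ p : Fin (n + 2) → ℂ,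
      (∀ F ∈ conormalIdeal (affineCone (sumEmbedding X)), aeval (Sum.elim p x.rep) F = 0) ∧
        ∀ i, p i * x.rep i = extData u i := by
  have mem_conormalVariety_iff {p : Fin (n + 2) → ℂ} (hp : p ≠ 0) :=
    mk_mem_conormalVariety_iff (isPrime_homIdeal_sumEmbedding hX) (sumEmbedding_nonempty hne) hp
      x.rep_nonzero
  rw [x.mk_rep] at mem_conormalVariety_iff
  constructor
  · rintro ⟨⟨y, x⟩, ⟨hyx, t, ht, mul_eq⟩, rfl⟩
    refine ⟨t⁻¹ • y.rep, fun F hF => ?_, fun i => ?_⟩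
    · rw [← y.mk_rep, mem_conormalVariety_iff y.rep_nonzero] at hyx
      rw [← one_smul ℂ x.rep]
      exact aeval_smul_smul_eq_zero_of_mem_conormalIdeal smul_mem_affineCone (inv_ne_zero ht) hyx hF
    · rw [Pi.smul_apply, smul_eq_mul, mul_assoc]
      exact (congrArg _ (mul_eq i)).trans (inv_mul_cancel_left₀ ht _)
  · rintro ⟨p, hp, mul_eq⟩
    have p_ne_zero : p ≠ 0 := by
      rintro rfl
      exact extData_ne_zero hu (_root_.funext fun i => (mul_eq i).symm.trans (zero_mul _))
    obtain ⟨t, ht, rep_eq⟩ := exists_mk_rep_eq_smul p_ne_zero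
    refine ⟨(_, x), ⟨(mem_conormalVariety_iff p_ne_zero).2 hp, t, ht, fun i => ?_⟩, rfl⟩
    rw [rep_eq, Pi.smul_apply, smul_eq_mul, mul_assoc, mul_eq]

theorem mem_dualCriticalPoints_iff {x : ProjSpace (Fin (n + 2))} :
    x ∈ dualCriticalPoints X u ↔ x ∈ regularPoints (dualVariety (sumEmbedding X)) ∧
      (∀ i, x.rep i ≠ 0) ∧
        (fun i => extData u i / x.rep i) ∈
          normalSpan (homIdeal (dualVariety (sumEmbedding X))) x.rep := by
  rw [← orthogonal_tangentSpace_iff]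
  rfl

theorem X_notMem_homIdeal_dualVariety_sumEmbedding (hX : (homIdeal X).IsPrime)
    (hne : X.Nonempty) (i : Fin (n + 2)) :
    MvPolynomial.X i ∉ homIdeal (dualVariety (sumEmbedding X)) := by
  rw [homIdeal_dualVariety (isPrime_homIdeal_sumEmbedding hX) (sumEmbedding_nonempty hne),
    Ideal.mem_comap, rename_X]
  intro h
  let b : Fin (n + 2) → ℂ := Fin.snoc (α := fun _ => ℂ) (fun _ => -1) 1
  have shiftVec_b : shiftVec b = 0 := by
    ext i
    simp [b, shiftVec_apply]
  have conormal : Sum.elim (0 : Fin (n + 1) → ℂ) (shiftVec b) ∈ conormalCone (affineCone X) := by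
    rw [shiftVec_b]
    exact mem_conormalCone.2 ⟨fun h0 => absurd rfl h0, Submodule.zero_mem _⟩
  have b_apply_eq_zero := mem_vanishingIdeal_iff.1 h (Sum.elim (sumExt 0) b)
    (mem_conormalCone_sumEmbedding.2 ⟨0, rfl, conormal⟩)
  rw [aeval_X, Sum.elim_inr] at b_apply_eq_zero
  cases i using Fin.lastCases <;> simp [b] at b_apply_eq_zero

theorem mem_homIdeal_dualVariety_of_shift_mem (hX : (homIdeal X).IsPrime) (hne : X.Nonempty)
    {f : MvPolynomial (Fin (n + 1)) ℂ}
    (hf : shift n f ∈ homIdeal (dualVariety (sumEmbedding X))) :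
    f ∈ homIdeal (dualVariety X) := by
  rw [homIdeal_dualVariety (isPrime_homIdeal_sumEmbedding hX) (sumEmbedding_nonempty hne)] at hf
  rw [homIdeal_dualVariety hX hne]
  refine mem_vanishingIdeal_iff.2 fun z hz => ?_
  rw [← Sum.elim_comp_inl_inr z] at hz ⊢
  let b : Fin (n + 2) → ℂ := Fin.snoc (α := fun _ => ℂ) (z ∘ Sum.inr) 0
  have shiftVec_b : shiftVec b = z ∘ Sum.inr := by
    ext i
    simp [b, shiftVec_apply]
  have vanishes := mem_vanishingIdeal_iff.1 (Ideal.mem_comap.1 hf)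
    (Sum.elim (sumExt (z ∘ Sum.inl)) b)
    (mem_conormalCone_sumEmbedding.2 ⟨_, rfl, shiftVec_b.symm ▸ hz⟩)
  change aeval _ (rename Sum.inr f) = 0
  rw [aeval_rename, Sum.elim_comp_inr, aeval_shift, shiftVec_b] at vanishes
  rwa [aeval_rename, Sum.elim_comp_inr]

theorem prod_X_mul_shift_notMem_homIdeal (hX : (homIdeal X).IsPrime) (hne : X.Nonempty)
    {m : MvPolynomial (Fin (n + 1)) ℂ} (hm : m ∉ homIdeal (dualVariety X)) :
    (∏ i, MvPolynomial.X i) * shift n m ∉ homIdeal (dualVariety (sumEmbedding X)) := by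
  have isPrime :=
    isPrime_homIdeal_dualVariety (isPrime_homIdeal_sumEmbedding hX) (sumEmbedding_nonempty hne)
  intro h
  rcases isPrime.mem_or_mem h with prod_mem | shift_mem
  · obtain ⟨i, -, X_mem⟩ := isPrime.prod_mem_iff.1 prod_mem
    exact X_notMem_homIdeal_dualVariety_sumEmbedding hX hne i X_mem
  · exact hm (mem_homIdeal_dualVariety_of_shift_mem hX hne shift_mem)

theorem aeval_prod_X_mul_shift_ne_zero_iff {b : Fin (n + 2) → ℂ}
    {m : MvPolynomial (Fin (n + 1)) ℂ} :
    aeval b ((∏ i, MvPolynomial.X i) * shift n m) ≠ 0 ↔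
      (∀ i, b i ≠ 0) ∧ aeval (shiftVec b) m ≠ 0 := by
  simp only [map_mul, map_prod, aeval_X, aeval_shift, mul_ne_zero_iff, Finset.prod_ne_zero_iff,
    Finset.mem_univ, forall_const]

variable {g : Fin l → MvPolynomial (Fin (n + 1)) ℂ} {b : Fin (n + 2) → ℂ}

theorem forall_conormalIdeal_of_forall_criticalIdeal (hX : (homIdeal X).IsPrime)
    (hne : X.Nonempty) (hg : DefinesVariety g (dualVariety X))
    (hI : ∀ f ∈ criticalIdeal g c u, aeval b f = 0)
    (hb : ∃ y ∈ exceptionalIdeal g c, aeval b y ≠ 0) :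
    ∀ F ∈ conormalIdeal (affineCone (sumEmbedding X)),
      aeval (Sum.elim (fun i => extData u i / b i) b) F = 0 := by
  obtain ⟨b_ne_zero, a, s, minor_ne_zero⟩ := exists_exceptionalIdeal_aeval_ne_zero_iff.1 hb
  have shift_mem : shiftVec b ∈ affineCone (dualVariety X) :=
    hg.mem_affineCone_iff.2 (forall_criticalIdeal_iff.1 hI).1
  have shift_vanishes : ∀ f ∈ homIdeal (dualVariety X), aeval (shiftVec b) f = 0 :=
    fun f hf => mem_vanishingIdeal_iff.1 hf _ shift_mem
  have mem_normalSpan : (fun i : Fin (n + 1) => u i / b i.castSucc) ∈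
      normalSpan (homIdeal (dualVariety X)) (shiftVec b) := by
    refine Submodule.span_le.2 ?_
      (mem_span_gradient_of_forall_criticalIdeal hI b_ne_zero minor_ne_zero)
    rintro _ ⟨j, rfl⟩
    exact gradient_mem_normalSpan _ (hg.mem_homIdeal (a j))
  have cone_dual := isIrreducibleCone_affineCone (isPrime_homIdeal_dualVariety hX hne)
  refine forall_conormalIdeal_sumEmbedding_iff.2 ⟨_, extData_div_eq_sumExt b_ne_zero
    (mem_perp.1 (cone_dual.mem_perp_normalSpan shift_vanishes) _ mem_normalSpan), ?_⟩
  exact (forall_conormalIdeal_dualVariety_iff hX hne).1 fun F hF =>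
    mem_vanishingIdeal_iff.1 hF _ (mem_conormalCone.2 ⟨shift_mem, mem_normalSpan⟩)

theorem aeval_eq_zero_of_mem_criticalIdeal_of_conormal (hX : (homIdeal X).IsPrime)
    (hne : X.Nonempty) (hg : DefinesVariety g (dualVariety X)) {a : Fin c → Fin l}
    {s : Fin c → Fin (n + 1)} (chart : IsJacobianChart (affineCone (dualVariety X)) (g ∘ a) s)
    {p : Fin (n + 2) → ℂ}
    (hp : ∀ F ∈ conormalIdeal (affineCone (sumEmbedding X)), aeval (Sum.elim p b) F = 0)
    (hpu : ∀ i, p i * b i = extData u i) (hs : aeval (shiftVec b) (jacobianMinor (g ∘ a) s) ≠ 0)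
    {f : MvPolynomial (Fin (n + 2)) ℂ} (hf : f ∈ criticalIdeal g c u) : aeval b f = 0 := by
  obtain ⟨p, rfl, conormal⟩ := forall_conormalIdeal_sumEmbedding_iff.1 hp
  have shift_vanishes : ∀ h ∈ homIdeal (dualVariety X), aeval (shiftVec b) h = 0 :=
    fun h hh => aeval_eq_zero_of_mem_homIdeal_dualVariety hX hne conormal hh
  refine aeval_eq_zero_of_mem_criticalIdeal (fun j => shift_vanishes _ (hg.mem_homIdeal j))
    ((finrank_range_le_card _).trans_eq (Fintype.card_fin c)) (fun j => ?_)
    (chart.mem_span_gradient ((forall_conormalIdeal_dualVariety_iff hX hne).2 conormal) hs)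
    (fun i => ?_) hf
  · rw [← chart.normalSpan_eq shift_vanishes hs]
    exact gradient_mem_normalSpan _ (hg.mem_homIdeal j)
  · rw [← extData_castSucc u, ← hpu, sumExt_castSucc]

theorem aeval_eq_zero_of_mem_likelihoodIdeal_of_forall_dualLikelihoodIdeal
    (hX : (homIdeal X).IsPrime) (hne : X.Nonempty) (hg : DefinesVariety g (dualVariety X))
    (hb : ∀ f ∈ dualLikelihoodIdeal g c u, aeval b f = 0)
    {Φ : MvPolynomial (Fin (n + 1) ⊕ Fin (n + 2)) ℂ}
    (hΦ : Φ ∈ likelihoodIdeal (affineCone (sumEmbedding X))) : aeval (Sum.elim u b) Φ = 0 := by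
  let specialization : MvPolynomial (Fin (n + 1) ⊕ Fin (n + 2)) ℂ →ₐ[ℂ] _ :=
    aeval (Sum.elim (fun i => C (u i)) (MvPolynomial.X : _ → MvPolynomial (Fin (n + 2)) ℂ))
  have aeval_specialization (b : Fin (n + 2) → ℂ) :
      aeval b (specialization Φ) = aeval (Sum.elim u b) Φ := by
    rw [comp_aeval_apply]
    congr 2
    ext (i | i) <;> simp
  rw [← aeval_specialization]
  refine aeval_eq_zero_of_forall_saturation (I := criticalIdeal g c u)
    (J := exceptionalIdeal g c) (fun b hI y hy hyb => ?_) hb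
  rw [aeval_specialization]
  refine aeval_eq_zero_of_mem_likelihoodIdeal
    (forall_conormalIdeal_of_forall_criticalIdeal hX hne hg hI ⟨y, hy, hyb⟩) (fun i => ?_) hΦ
  have b_ne_zero := (exists_exceptionalIdeal_aeval_ne_zero_iff.1 ⟨y, hy, hyb⟩).1
  rw [div_mul_cancel₀ _ (b_ne_zero _), extData_castSucc]

theorem dualLikelihoodLocus_eq_projZeros (hX : (homIdeal X).IsPrime) (hne : X.Nonempty)
    (hg : DefinesVariety g (dualVariety X)) {a : Fin c → Fin l} {s : Fin c → Fin (n + 1)}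
    (chart : IsJacobianChart (affineCone (dualVariety X)) (g ∘ a) s) (hu : u ≠ 0)
    (generic : IsGenericData (affineCone (sumEmbedding X))
      ((∏ i, MvPolynomial.X i) * shift n (jacobianMinor (g ∘ a) s)) u) :
    dualLikelihoodLocus X u = projZeros (dualLikelihoodIdeal g c u : Set _) := by
  ext x
  rw [mem_dualLikelihoodLocus_iff hX hne hu]
  constructor
  · rintro ⟨p, hp, hpu⟩
    obtain ⟨x_ne_zero, minor_ne_zero⟩ := aeval_prod_X_mul_shift_ne_zero_iff.1 <|
      generic x.rep x.rep_nonzero fun Φ hΦ => aeval_eq_zero_of_mem_likelihoodIdeal hp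
        (fun i => (hpu _).trans (extData_castSucc u i)) hΦ
    obtain ⟨y, hy, y_ne_zero⟩ :=
      exists_exceptionalIdeal_aeval_ne_zero_iff.2 ⟨x_ne_zero, a, s, minor_ne_zero⟩
    exact fun f hf => aeval_eq_zero_of_mem_saturation (fun h hh =>
      aeval_eq_zero_of_mem_criticalIdeal_of_conormal hX hne hg chart hp hpu minor_ne_zero hh)
      hy y_ne_zero hf
  · intro hx
    obtain ⟨x_ne_zero, minor_ne_zero⟩ := aeval_prod_X_mul_shift_ne_zero_iff.1 <|
      generic x.rep x.rep_nonzero fun Φ hΦ =>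
        aeval_eq_zero_of_mem_likelihoodIdeal_of_forall_dualLikelihoodIdeal hX hne hg hx hΦ
    exact ⟨_, forall_conormalIdeal_of_forall_criticalIdeal hX hne hg
      (fun f hf => hx f (le_saturation _ _ hf))
      (exists_exceptionalIdeal_aeval_ne_zero_iff.2 ⟨x_ne_zero, a, s, minor_ne_zero⟩),
      fun i => div_mul_cancel₀ _ (x_ne_zero i)⟩

theorem dualCriticalPoints_eq_dualLikelihoodLocus (hX : (homIdeal X).IsPrime) (hne : X.Nonempty)
    {r : ℕ} {h : Fin r → MvPolynomial (Fin (n + 2)) ℂ} {s : Fin r → Fin (n + 2)}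
    (chart : IsJacobianChart (affineCone (dualVariety (sumEmbedding X))) h s) (hu : u ≠ 0)
    (generic : ∀ i, IsGenericData (affineCone (sumEmbedding X)) (MvPolynomial.X i) u)
    (generic' : IsGenericData (affineCone (sumEmbedding X)) (jacobianMinor h s) u) :
    dualCriticalPoints X u = dualLikelihoodLocus X u := by
  have hX' := isPrime_homIdeal_sumEmbedding hX
  have hne' := sumEmbedding_nonempty hne
  have isPrime_dual := isPrime_homIdeal_dualVariety hX' hne'
  ext x
  rw [mem_dualCriticalPoints_iff]
  constructor
  · rintro ⟨x_regular, x_ne_zero, mem_normalSpan⟩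
    refine (mem_dualLikelihoodLocus_iff hX hne hu).2
      ⟨_, ?_, fun i => div_mul_cancel₀ _ (x_ne_zero i)⟩
    exact (forall_conormalIdeal_dualVariety_iff hX' hne').1 fun F hF => mem_vanishingIdeal_iff.1 hF
      _ (mem_conormalCone.2 ⟨rep_mem_affineCone.2 x_regular.1, mem_normalSpan⟩)
  · intro hx
    have x_mem : x ∈ dualVariety (sumEmbedding X) :=
      Set.image_mono (fun _ hz => hz.1) hx
    obtain ⟨p, hp, hpu⟩ := (mem_dualLikelihoodLocus_iff hX hne hu).1 hx
    have likelihood : ∀ Φ ∈ likelihoodIdeal (affineCone (sumEmbedding X)),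
        aeval (Sum.elim u x.rep) Φ = 0 := fun Φ hΦ =>
      aeval_eq_zero_of_mem_likelihoodIdeal hp (fun i => (hpu _).trans (extData_castSucc u i)) hΦ
    have x_ne_zero (i : Fin (n + 2)) : x.rep i ≠ 0 := by
      simpa only [aeval_X] using generic i x.rep x.rep_nonzero likelihood
    have minor_ne_zero := generic' x.rep x.rep_nonzero likelihood
    obtain rfl : p = fun i => extData u i / x.rep i :=
      _root_.funext fun i => eq_div_of_mul_eq (x_ne_zero i) (hpu i)
    refine ⟨chart.mem_regularPoints x_mem minor_ne_zero, x_ne_zero, ?_⟩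
    rw [homIdeal, chart.normalSpan_eq
      (fun f hf => mem_vanishingIdeal_iff.1 hf _ (rep_mem_affineCone.2 x_mem)) minor_ne_zero]
    exact chart.mem_span_gradient ((forall_conormalIdeal_dualVariety_iff hX' hne').2 hp)
      minor_ne_zero

theorem exists_forall_isGenericData_of_notMem_homIdeal {X : Set (ProjSpace (Fin (n + 2)))}
    (hX : (homIdeal X).IsPrime) (hne : X.Nonempty) {f : MvPolynomial (Fin (n + 2)) ℂ} {d : ℕ}
    (hf : f ∉ homIdeal (dualVariety X)) (hhom : f.IsHomogeneous d) :
    ∃ F : MvPolynomial (Fin (n + 1)) ℂ, F ≠ 0 ∧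
      ∀ u, aeval u F ≠ 0 → IsGenericData (affineCone X) f u :=
  exists_forall_isGenericData (isIrreducibleCone_affineCone hX)
    (fun h => hf (by rwa [homIdeal_dualVariety hX hne])) hhom

end CriticalPoints

theorem theorem3p1_general {n l c : ℕ} {X : Set (ProjSpace (Fin (n + 1)))} (hne : X.Nonempty)
    (hX : (homIdeal X).IsPrime) {g : Fin l → MvPolynomial (Fin (n + 1)) ℂ}
    (hg : DefinesVariety g (dualVariety X)) (hc : HasCodim (dualVariety X) c) :
    ∃ F : MvPolynomial (Fin (n + 1)) ℂ, F ≠ 0 ∧ ∀ u : Fin (n + 1) → ℂ, eval u F ≠ 0 →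
      dualLikelihoodLocus X u = projZeros (dualLikelihoodIdeal g c u : Set _) ∧
        dualCriticalPoints X u = projZeros (dualLikelihoodIdeal g c u : Set _) := by
  have hX' := isPrime_homIdeal_sumEmbedding hX
  have hne' := sumEmbedding_nonempty hne
  have := isPrime_homIdeal_dualVariety hX hne
  obtain ⟨a, s, chart⟩ := hg.exists_isJacobianChart hc
  obtain ⟨r, h, t, h_hom, chart'⟩ :=
    exists_isHomogeneous_isJacobianChart (isPrime_homIdeal_dualVariety hX' hne')
  obtain ⟨d, minor_hom⟩ := isHomogeneous_jacobianMinor (fun j => hg.homogeneous (a j)) s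
  obtain ⟨d', minor_hom'⟩ := isHomogeneous_jacobianMinor h_hom t
  obtain ⟨F, F_ne_zero, generic⟩ := exists_forall_isGenericData_of_notMem_homIdeal hX' hne'
    (prod_X_mul_shift_notMem_homIdeal hX hne chart.notMem)
    ((IsHomogeneous.prod _ _ _ fun i _ => isHomogeneous_X ℂ i).mul (isHomogeneous_shift minor_hom))
  obtain ⟨F', F'_ne_zero, generic'⟩ :=
    exists_forall_isGenericData_of_notMem_homIdeal hX' hne' chart'.notMem minor_hom'
  refine ⟨F * F' * MvPolynomial.X 0,
    mul_ne_zero (mul_ne_zero F_ne_zero F'_ne_zero) (X_ne_zero 0), fun u hu => ?_⟩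
  simp only [map_mul, eval_X, mul_ne_zero_iff] at hu
  obtain ⟨⟨hF, hF'⟩, u_apply_ne_zero⟩ := hu
  have u_ne_zero : u ≠ 0 := ne_of_apply_ne (· 0) u_apply_ne_zero
  have locus_eq := dualLikelihoodLocus_eq_projZeros hX hne hg chart u_ne_zero (generic u hF)
  refine ⟨locus_eq, (dualCriticalPoints_eq_dualLikelihoodLocus hX hne chart' u_ne_zero
    (fun i b hb hΦ => ?_) (generic' u hF')).trans locus_eq⟩
  rw [aeval_X]
  exact (aeval_prod_X_mul_shift_ne_zero_iff.1 (generic u hF b hb hΦ)).1 i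

end DualMLE

end

theorem theorem3p1 (n l c : ℕ) (X : Set (DualMLE.ProjSpace (Fin (n + 1))))
    (hX : DualMLE.IsProjectiveVariety X)
    (g : Fin l → MvPolynomial (Fin (n + 1)) ℂ)
    (hg : DualMLE.DefinesVariety g (DualMLE.dualVariety X))
    (hc : DualMLE.HasCodim (DualMLE.dualVariety X) c) :
    ∃ F : MvPolynomial (Fin (n + 1)) ℂ, F ≠ 0 ∧
      ∀ u : Fin (n + 1) → ℂ, MvPolynomial.eval u F ≠ 0 →
        DualMLE.dualLikelihoodLocus X u =
            DualMLE.projZeros (DualMLE.dualLikelihoodIdeal g c u : Set (MvPolynomial (Fin (n + 2)) ℂ)) ∧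
          DualMLE.dualCriticalPoints X u =
            DualMLE.projZeros (DualMLE.dualLikelihoodIdeal g c u : Set (MvPolynomial (Fin (n + 2)) ℂ)) :=
  DualMLE.theorem3p1_general hX.nonempty hX.irreducible hg hc
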